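/- Let $(M,g)$ be a simply connected, complete, Ricci-flat Riemannian $4$-manifold with an effective smooth isometric action of $T=S^1\times S^1$ that has at least one fixed point and no nontrivial finite isotropy groups. Let $J$ be a Hermitian structure on $(M,g)$ (a compatible integrable almost complex structure), put $\omega(X,Y)=g(JX,Y)$, orient $M$ by $\omega\wedge\omega$, and assume that the self-dual part $\mathcal W^+$ of the Weyl tensor is not identically zero. Let $\Omega>0$ be the (smooth, non-constant) conformal factor for which $(M,\Omega^2g,J)$ is Kähler, and assume that $T$ acts by isometries of $\Omega^2g$ and is Hamiltonian for the Kähler form $\Omega^2\omega$. Let $\partial_\tau,\partial_y$ be Killing fields generated by a basis of the Lie algebra of $T$, with $\partial_\tau$ the Killing field $\xi_a=J^b{}_a\partial_b\Omega^{-1}$. Let $\rho=\sqrt{\det G}$, where $G$ is the Gram matrix of $(\partial_\tau,\partial_y)$, and suppose that $(M,g)$ has a rod structure in Weyl–Papapetrou coordinates $(\rho,\zeta)$: the function $\zeta$ on $M$ is smooth where $\rho>0$, there the metric orthogonal to the orbits is $e^{2\nu}(d\rho^2+d\zeta^2)$, and $(\rho,\zeta)$ induces a homeomorphism from $M/T$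 onto the closed half-plane $\{\rho\ge0\}$; the fixed points of $T$ correspond to $(0,z_1),\dots,(0,z_n)$ with $z_1<\dots<z_n$; and on each rod $I_i=(z_i,z_{i+1})$, $i=0,\dots,n$ ($z_0=-\infty$, $z_{n+1}=\infty$), the Gram matrix has rank one, with constant kernel spanned by the rod vector $v_i$. Let $V(\rho,\zeta)$, $\rho>0$, be the potential of the Tod form of this structure. That is, $V$ is smooth with $\frac1\rho(\rho V_\rho)_\rho+V_{\zeta\zeta}=0$ and $\Omega^{-1}=\frac12\rho V_\rho$; and there are a constant $c\ne0$ and a function $H$ with $H_\rho=-\rho V_\zeta$, $H_\zeta=\rho V_\rho$ such that, locally on $\{\rho>0\}\subset M$, in coordinates $(\tau,y,\rho,\zeta)$, $$g=W^{-1}(d\tau+F\,dy)^2+W\rho^2dy^2+e^{2\nu}(d\rho^2+d\zeta^2),\qquad \omega=\tfrac12(d\tau+F\,dy)\wedge d(\rho V_\rho)-\tfrac12W\rho^2\,d(V_\zeta)\wedge dy,$$ where $$W=\frac1{2c}\Big(\rho V_\rho+\frac{V_\rho^2V_{\zeta\zeta}}{V_{\zeta\zeta}^2+V_{\zeta\rho}^2}\Big),\quad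 e^{2\nu}=\frac{W\rho^2}4\big(V_{\zeta\zeta}^2+V_{\zeta\rho}^2\big),\quad F=\frac1{2c}\Big(\frac{\rho V_\rho^2V_{\rho\zeta}}{V_{\zeta\zeta}^2+V_{\zeta\rho}^2}-V_\zeta\rho^2-2H\Big).$$ Then there are functions $f,g:\mathbb R\to\mathbb R$ (this $g$ is not the metric) such that, as $\rho\to0$, $$V=f(\zeta)\log\rho^2+g(\zeta)+O(\rho^2),$$ where $f$ is continuous, positive, and piecewise linear with breaks at most at the $z_i$ (affine on every rod), and $g$ is piecewise smooth with breaks at most at the $z_i$ (smooth on every rod). More precisely, on every rod $I_i$ there is a function $E_i$, smooth on $[0,\infty)\times I_i$, with $V(\rho,\zeta)=f(\zeta)\log\rho^2+g(\zeta)+E_i(\rho^2,\zeta)$ for all $\rho>0$, $\zeta\in I_i$, and $E_i(\rho^2,\zeta)=O(\rho^2)$ as $\rho\to0$, locally uniformly in $\zeta\in I_i$. -/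

import Mathlib

open Bundle
open scoped Manifold ContDiff Topology

noncomputable section

namespace ToricInstanton

/-- The model space of a four-manifold. -/
abbrev E4 : Type := EuclideanSpace ℝ (Fin 4)

/-- The two-torus. -/
abbrev Torus : Type := Circle × Circle

/-- The exponential map of the torus, from its Lie algebra `ℝ × ℝ`
(the standard generators have period `2π`). -/
def torusExp (a : ℝ × ℝ) : Torus := (Circle.exp a.1, Circle.exp a.2)

/-- The partial derivative of a function on `ℝ⁴` in the `i`-th coordinate direction. -/
def pd (i : Fin 4) (F : E4 → ℝ) (y : E4) : ℝ := fderiv ℝ F y (EuclideanSpace.single i 1)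

/-! ### Differential geometry on a four-manifold -/

section Smooth

variable {M : Type*} [TopologicalSpace M] [ChartedSpace E4 M]

/-- The differential of a real function, as a one-form. -/
def dform (f : M → ℝ) (p : M) (v : TangentSpace (𝓡 4) p) : ℝ :=
  mfderiv (𝓡 4) 𝓘(ℝ, ℝ) f p v

/-- The coordinate vector field `∂ᵢ` of the chart around `x₀`, at the point with
coordinates `y`. -/
def coordVec (x₀ : M) (y : E4) (i : Fin 4) :
    TangentSpace (𝓡 4) ((extChartAt (𝓡 4) x₀).symm y) :=
  mfderiv 𝓘(ℝ, E4) (𝓡 4) (extChartAt (𝓡 4) x₀).symm y (EuclideanSpace.single i (1 : ℝ) : E4)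

/-- The `k`-th component, in the chart around `x₀`, of a tangent vector at the point with
coordinates `y`. -/
def component (x₀ : M) (y : E4) (k : Fin 4)
    (v : TangentSpace (𝓡 4) ((extChartAt (𝓡 4) x₀).symm y)) : ℝ :=
  let u : E4 := mfderiv (𝓡 4) 𝓘(ℝ, E4) (extChartAt (𝓡 4) x₀) ((extChartAt (𝓡 4) x₀).symm y) v
  u k

/-- A field of endomorphisms of the tangent spaces. -/
abbrev EndField (M : Type*) [TopologicalSpace M] [ChartedSpace E4 M] : Type _ :=
  (p : M) → TangentSpace (𝓡 4) p →L[ℝ] TangentSpace (𝓡 4) p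

/-- The component functions `J^k_i` of a field of endomorphisms: `J ∂ᵢ = ∑ₖ J^k_i ∂ₖ`. -/
def endC (J : EndField M) (x₀ : M) (k i : Fin 4) (y : E4) : ℝ :=
  component x₀ y k (J _ (coordVec x₀ y i))

/-- The components of the Nijenhuis tensor
`[J∂ᵢ, J∂ⱼ] - J[J∂ᵢ, ∂ⱼ] - J[∂ᵢ, J∂ⱼ] - [∂ᵢ, ∂ⱼ]`. -/
def nijenhuisC (J : EndField M) (x₀ : M) (k i j : Fin 4) (y : E4) : ℝ :=
  ∑ l, (endC J x₀ l i y * pd l (endC J x₀ k j) y - endC J x₀ l j y * pd l (endC J x₀ k i) y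
    - endC J x₀ k l y * (pd i (endC J x₀ l j) y - pd j (endC J x₀ l i) y))

variable [MulAction Torus M]

/-- The vector field on `M` generated by the element `a` of the Lie algebra of the torus. -/
def fundField (a : ℝ × ℝ) (p : M) : TangentSpace (𝓡 4) p :=
  mfderiv 𝓘(ℝ, ℝ) (𝓡 4) (fun t : ℝ => torusExp (t • a) • p) 0 (1 : ℝ)

/-- The differential of the diffeomorphism of `M` given by a torus element. -/
def push (t : Torus) (p : M) (v : TangentSpace (𝓡 4) p) : TangentSpace (𝓡 4) (t • p) :=
  mfderiv (𝓡 4) (𝓡 4) (fun q : M => t • q) p v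

end Smooth

/-! ### Curvature, in charts -/

section Riemannian

variable {M : Type*} [TopologicalSpace M] [ChartedSpace E4 M]
  [RiemannianBundle (fun x : M => TangentSpace (𝓡 4) x)]

/-- The components `g_ij` of the Riemannian metric. -/
def metricC (x₀ : M) (i j : Fin 4) (y : E4) : ℝ :=
  inner ℝ (coordVec x₀ y i) (coordVec x₀ y j)

/-- The components `g^ij` of the inverse metric. -/
def invMetricC (x₀ : M) (i j : Fin 4) (y : E4) : ℝ :=
  (Matrix.of fun k l => metricC x₀ k l y)⁻¹ i j

/-- The Christoffel symbols `Γ^k_ij` of the Levi-Civita connection. -/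
def christoffel (x₀ : M) (k i j : Fin 4) (y : E4) : ℝ :=
  (1 / 2) * ∑ l, invMetricC x₀ k l y *
    (pd i (metricC x₀ l j) y + pd j (metricC x₀ l i) y - pd l (metricC x₀ i j) y)

/-- The curvature `R^k_lij`, the `k`-th component of `R(∂ᵢ, ∂ⱼ)∂ₗ`. -/
def riemannUp (x₀ : M) (k l i j : Fin 4) (y : E4) : ℝ :=
  pd i (christoffel x₀ k j l) y - pd j (christoffel x₀ k i l) y
    + ∑ m, (christoffel x₀ k i m y * christoffel x₀ m j l y
      - christoffel x₀ k j m y * christoffel x₀ m i l y)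

/-- The curvature `R_abcd` with all indices lowered. -/
def riemannC (x₀ : M) (a b c d : Fin 4) (y : E4) : ℝ :=
  ∑ k, metricC x₀ a k y * riemannUp x₀ k b c d y

/-- The Ricci curvature `R_ij = R^k_ikj`. -/
def ricciC (x₀ : M) (i j : Fin 4) (y : E4) : ℝ := ∑ k, riemannUp x₀ k i k j y

/-- The scalar curvature. -/
def scalarC (x₀ : M) (y : E4) : ℝ := ∑ i, ∑ j, invMetricC x₀ i j y * ricciC x₀ i j y

/-- The Weyl tensor in dimension four. -/
def weylC (x₀ : M) (a b c d : Fin 4) (y : E4) : ℝ :=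
  riemannC x₀ a b c d y
    - (1 / 2) * (metricC x₀ a c y * ricciC x₀ b d y - metricC x₀ a d y * ricciC x₀ b c y
      - metricC x₀ b c y * ricciC x₀ a d y + metricC x₀ b d y * ricciC x₀ a c y)
    + (scalarC x₀ y / 6) *
      (metricC x₀ a c y * metricC x₀ b d y - metricC x₀ a d y * metricC x₀ b c y)

/-- The fundamental two-form `ω(v, w) = g(Jv, w)`. -/
def fundForm (J : EndField M) (p : M) (v w : TangentSpace (𝓡 4) p) : ℝ := inner ℝ (J p v) w

/-- The components of the fundamental two-form. -/
def fundFormC (J : EndField M) (x₀ : M) (i j : Fin 4) (y : E4) : ℝ :=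
  fundForm J _ (coordVec x₀ y i) (coordVec x₀ y j)

/-- The components of the Riemannian volume form `(1/2) ω ∧ ω`, for the orientation that is
induced by the Hermitian structure. -/
def volC (J : EndField M) (x₀ : M) (a b c d : Fin 4) (y : E4) : ℝ :=
  fundFormC J x₀ a b y * fundFormC J x₀ c d y - fundFormC J x₀ a c y * fundFormC J x₀ b d y
    + fundFormC J x₀ a d y * fundFormC J x₀ b c y

/-- The components of `⋆W`, the Weyl tensor composed with the Hodge star of two-forms. -/
def starWeylC (J : EndField M) (x₀ : M) (a b c d : Fin 4) (y : E4) : ℝ :=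
  (1 / 2) * ∑ p, ∑ q, ∑ m, ∑ n, volC J x₀ a b p q y * invMetricC x₀ p m y *
    invMetricC x₀ q n y * weylC x₀ m n c d y

/-- The components of the self-dual part `W⁺ = (1/2) (W + ⋆W)` of the Weyl tensor. -/
def weylPlusC (J : EndField M) (x₀ : M) (a b c d : Fin 4) (y : E4) : ℝ :=
  (1 / 2) * (weylC x₀ a b c d y + starWeylC J x₀ a b c d y)

variable (M) in
/-- The metric is Ricci-flat. -/
def RicciFlat : Prop :=
  ∀ x₀ : M, ∀ y ∈ (extChartAt (𝓡 4) x₀).target, ∀ i j, ricciC x₀ i j y = 0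

/-- The self-dual part of the Weyl tensor does not vanish identically. -/
def WeylPlusNonzero (J : EndField M) : Prop :=
  ∃ x₀ : M, ∃ y ∈ (extChartAt (𝓡 4) x₀).target, ∃ a b c d, weylPlusC J x₀ a b c d y ≠ 0

/-- `J` is a Hermitian structure: a smooth almost complex structure that is compatible with the
metric and integrable. -/
structure IsHermitian (J : EndField M) : Prop where
  sq : ∀ p v, J p (J p v) = -v
  compatible : ∀ p v w, inner ℝ (J p v) (J p w) = inner ℝ v w
  smooth : ∀ x₀ k i, ContDiffOn ℝ ∞ (endC J x₀ k i) (extChartAt (𝓡 4) x₀).target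
  integrable : ∀ x₀, ∀ y ∈ (extChartAt (𝓡 4) x₀).target, ∀ k i j, nijenhuisC J x₀ k i j y = 0

/-- The components of the fundamental two-form `Ω² ω` of the metric `Ω² g`. -/
def confFormC (J : EndField M) (Ω : M → ℝ) (x₀ : M) (i j : Fin 4) (y : E4) : ℝ :=
  Ω ((extChartAt (𝓡 4) x₀).symm y) ^ 2 * fundFormC J x₀ i j y

/-- For a Hermitian structure `J`: the metric `Ω² g` is Kähler with respect to `J`, and `Ω` is
a non-constant positive function (a strictly conformally Kähler structure). -/
structure IsConformallyKahler (J : EndField M) (Ω : M → ℝ) : Prop where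
  smooth : ContMDiff (𝓡 4) 𝓘(ℝ, ℝ) ∞ Ω
  pos : ∀ p, 0 < Ω p
  nonconstant : ∃ p q, Ω p ≠ Ω q
  closed : ∀ x₀, ∀ y ∈ (extChartAt (𝓡 4) x₀).target, ∀ i j k,
    pd i (confFormC J Ω x₀ j k) y + pd j (confFormC J Ω x₀ k i) y
      + pd k (confFormC J Ω x₀ i j) y = 0

variable [MulAction Torus M]

/-- The torus acts by isometries of `Ω² g`, and the action is Hamiltonian with respect to
the Kähler form `Ω² ω`. -/
structure IsHamiltonianIsometric (J : EndField M) (Ω : M → ℝ) : Prop where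
  isometric : ∀ (t : Torus) (p : M) (v w : TangentSpace (𝓡 4) p),
    Ω (t • p) ^ 2 * inner ℝ (push t p v) (push t p w) = Ω p ^ 2 * inner ℝ v w
  hamiltonian : ∀ a : ℝ × ℝ, ∃ μ : M → ℝ, ContMDiff (𝓡 4) 𝓘(ℝ, ℝ) ∞ μ ∧
    ∀ (p : M) (v : TangentSpace (𝓡 4) p),
      Ω p ^ 2 * fundForm J p (fundField a p) v = -dform μ p v

/-- The function `ρ`: the square root of the determinant of the Gram matrix of the Killing fields
generated by the elements `a`, `b` of the Lie algebra of the torus. -/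
def weylRho (a b : ℝ × ℝ) (p : M) : ℝ :=
  √(inner ℝ (fundField a p) (fundField a p) * inner ℝ (fundField b p) (fundField b p)
    - inner ℝ (fundField a p) (fundField b p) ^ 2)

end Riemannian

/-! ### Toric Hermitian instantons -/

section Instanton

variable (M : Type*) [MetricSpace M] [ChartedSpace E4 M]
  [RiemannianBundle (fun x : M => TangentSpace (𝓡 4) x)] [MulAction Torus M]

/-- A toric gravitational instanton: complete, Ricci-flat and simply connected, with a smooth
effective isometric torus action that has a fixed point and no nontrivial finite isotropy
group. -/
structure IsToricInstanton : Prop where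
  complete : CompleteSpace M
  simplyConnected : SimplyConnectedSpace M
  ricciFlat : RicciFlat M
  smooth_action : ContMDiffSMul ((𝓡 1).prod (𝓡 1)) (𝓡 4) ∞ Torus M
  effective : FaithfulSMul Torus M
  isometric : ∀ (t : Torus) (p : M) (v w : TangentSpace (𝓡 4) p),
    inner ℝ (push t p v) (push t p w) = inner ℝ v w
  fixed_point : ∃ p : M, ∀ t : Torus, t • p = p
  no_finite_isotropy : ∀ p : M,
    Finite (MulAction.stabilizer Torus p) → MulAction.stabilizer Torus p = ⊥

/-- A toric Hermitian instanton with `W⁺ ≠ 0`, with Hermitian structure `J` and conformal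
factor `Ω`. -/
structure IsToricHermitianInstanton (J : EndField M) (Ω : M → ℝ) : Prop where
  toric : IsToricInstanton M
  hermitian : IsHermitian J
  weylPlus : WeylPlusNonzero J
  conformallyKahler : IsConformallyKahler J Ω
  toricKahler : IsHamiltonianIsometric J Ω

end Instanton

/-- The `i`-th rod: the interval `(z_i, z_{i+1})` cut out by `z_1 < ⋯ < z_n`, where `z_0 = -∞`
and `z_{n+1} = ∞`. (In the code `z j` stands for `z_{j+1}`.) -/
def rod {n : ℕ} (z : Fin n → ℝ) (i : Fin (n + 1)) : Set ℝ :=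
  {s | ∀ j : Fin n, ((j : ℕ) < i → z j < s) ∧ ((i : ℕ) ≤ j → s < z j)}

section Rods

variable (M : Type*) [TopologicalSpace M] [ChartedSpace E4 M]
  [RiemannianBundle (fun x : M => TangentSpace (𝓡 4) x)] [MulAction Torus M]

/-- The rod structure of a toric instanton, in Weyl-Papapetrou coordinates `(ρ, ζ)` for the basis
`a`, `b` of the Lie algebra of the torus. The coordinates identify the orbit space with the
closed half-plane; the fixed points are the points `(0, z_i)`; the points of the rods are
those where the Gram matrix has rank one, and `v i` spans its kernel there (the Gram matrix is
positive semidefinite, so its kernel consists of the elements whose vector field vanishes). -/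
structure RodStructure (a b : ℝ × ℝ) where
  basis : LinearIndependent ℝ ![a, b]
  ζ : M → ℝ
  orbitSpace : ∃ e : Quotient (MulAction.orbitRel Torus M) ≃ₜ {q : ℝ × ℝ // 0 ≤ q.1},
    ∀ p : M, (e (Quotient.mk _ p) : ℝ × ℝ) = (weylRho a b p, ζ p)
  smooth : ContMDiffOn (𝓡 4) 𝓘(ℝ, ℝ) ∞ ζ {p | 0 < weylRho a b p}
  /-- The metric orthogonal to the torus orbits is a positive multiple of `dρ² + dζ²`. -/
  isothermal : ∀ p : M, 0 < weylRho a b p → ∃ k : ℝ, 0 < k ∧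
    ∀ v w : TangentSpace (𝓡 4) p,
      (∀ u : ℝ × ℝ, inner ℝ (fundField u p) v = 0) →
      (∀ u : ℝ × ℝ, inner ℝ (fundField u p) w = 0) →
      inner ℝ v w = k * (dform (weylRho a b) p v * dform (weylRho a b) p w
        + dform ζ p v * dform ζ p w)
  n : ℕ
  z : Fin n → ℝ
  strictMono : StrictMono z
  fixed_iff : ∀ p : M, (∀ t : Torus, t • p = p) ↔ weylRho a b p = 0 ∧ ∃ j, ζ p = z j
  v : Fin (n + 1) → ℝ × ℝ
  v_ne_zero : ∀ i, v i ≠ 0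
  kernel : ∀ (i : Fin (n + 1)) (p : M), weylRho a b p = 0 → ζ p ∈ rod z i →
    ∀ u : ℝ × ℝ, fundField u p = 0 ↔ ∃ s : ℝ, u = s • v i

end Rods

/-! ### The Tod form of the metric -/

/-- The partial derivative `V_ρ` of a function `V(ρ, ζ)`. -/
def dRho (V : ℝ → ℝ → ℝ) (r s : ℝ) : ℝ := deriv (fun r' => V r' s) r

/-- The partial derivative `V_ζ` of a function `V(ρ, ζ)`. -/
def dZeta (V : ℝ → ℝ → ℝ) (r s : ℝ) : ℝ := deriv (fun s' => V r s') s

/-- The open half-plane `ρ > 0`. -/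
def halfPlane : Set (ℝ × ℝ) := {q | 0 < q.1}

/-- `V(ρ, ζ)` is a smooth axisymmetric harmonic function on `ℝ³` away from the axis `ρ = 0`. -/
structure IsAxisymmetricHarmonic (V : ℝ → ℝ → ℝ) : Prop where
  smooth : ContDiffOn ℝ ∞ (fun q : ℝ × ℝ => V q.1 q.2) halfPlane
  laplace : ∀ r s, 0 < r →
    (1 / r) * deriv (fun r' => r' * dRho V r' s) r + dZeta (dZeta V) r s = 0

/-- `H` is the harmonic conjugate to `V`: `H_ρ = -ρ V_ζ` and `H_ζ = ρ V_ρ`. -/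
structure IsHarmonicConjugate (V H : ℝ → ℝ → ℝ) : Prop where
  smooth : ContDiffOn ℝ ∞ (fun q : ℝ × ℝ => H q.1 q.2) halfPlane
  rho : ∀ r s, 0 < r → dRho H r s = -r * dZeta V r s
  zeta : ∀ r s, 0 < r → dZeta H r s = r * dRho V r s

/-- `V_ζζ² + V_ζρ²`. -/
def todD (V : ℝ → ℝ → ℝ) (r s : ℝ) : ℝ := dZeta (dZeta V) r s ^ 2 + dRho (dZeta V) r s ^ 2

/-- The function `W` of the Tod metric. -/
def todW (c : ℝ) (V : ℝ → ℝ → ℝ) (r s : ℝ) : ℝ :=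
  1 / (2 * c) * (r * dRho V r s + dRho V r s ^ 2 * dZeta (dZeta V) r s / todD V r s)

/-- The function `e^{2ν}` of the Tod metric. -/
def todE (c : ℝ) (V : ℝ → ℝ → ℝ) (r s : ℝ) : ℝ := todW c V r s * r ^ 2 / 4 * todD V r s

/-- The function `F` of the Tod metric. -/
def todF (c : ℝ) (V H : ℝ → ℝ → ℝ) (r s : ℝ) : ℝ :=
  1 / (2 * c) * (r * dRho V r s ^ 2 * dRho (dZeta V) r s / todD V r s
    - dZeta V r s * r ^ 2 - 2 * H r s)

section Tod

variable {M : Type*} [TopologicalSpace M] [ChartedSpace E4 M]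
  [RiemannianBundle (fun x : M => TangentSpace (𝓡 4) x)] [MulAction Torus M]

/-- On the open set `U` the metric and the fundamental two-form have the Tod form in the
coordinates `(τ, y, ρ, ζ)`, with `∂_τ` and `∂_y` the Killing fields generated by `a` and `b`:
`g = W⁻¹ (dτ + F dy)² + W ρ² dy² + e^{2ν} (dρ² + dζ²)` and
`ω = (1/2) (dτ + F dy) ∧ d(ρ V_ρ) - (1/2) W ρ² d(V_ζ) ∧ dy`. -/
structure IsTodFormOn (J : EndField M) (a b : ℝ × ℝ) (ζ : M → ℝ) (c : ℝ) (V H : ℝ → ℝ → ℝ)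
    (τ y : M → ℝ) (U : Set M) : Prop where
  smooth_tau : ContMDiffOn (𝓡 4) 𝓘(ℝ, ℝ) ∞ τ U
  smooth_y : ContMDiffOn (𝓡 4) 𝓘(ℝ, ℝ) ∞ y U
  partial_tau : ∀ p ∈ U, dform τ p (fundField a p) = 1 ∧ dform y p (fundField a p) = 0
  partial_y : ∀ p ∈ U, dform τ p (fundField b p) = 0 ∧ dform y p (fundField b p) = 1
  metric : ∀ p ∈ U, ∀ v w : TangentSpace (𝓡 4) p,
    let ρ := weylRho a b
    let W := todW c V (ρ p) (ζ p)
    let F := todF c V H (ρ p) (ζ p)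
    inner ℝ v w =
      W⁻¹ * ((dform τ p v + F * dform y p v) * (dform τ p w + F * dform y p w))
        + W * ρ p ^ 2 * (dform y p v * dform y p w)
        + todE c V (ρ p) (ζ p) * (dform ρ p v * dform ρ p w + dform ζ p v * dform ζ p w)
  form : ∀ p ∈ U, ∀ v w : TangentSpace (𝓡 4) p,
    let ρ := weylRho a b
    let W := todW c V (ρ p) (ζ p)
    let F := todF c V H (ρ p) (ζ p)
    let θ := fun u : TangentSpace (𝓡 4) p => dform τ p u + F * dform y p u
    let α := dform (fun q => ρ q * dRho V (ρ q) (ζ q)) p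
    let β := dform (fun q => dZeta V (ρ q) (ζ q)) p
    fundForm J p v w =
      1 / 2 * (θ v * α w - θ w * α v)
        - 1 / 2 * W * ρ p ^ 2 * (β v * dform y p w - β w * dform y p v)

/-- `V` is the axisymmetric harmonic function, and `c` the constant, of the Tod form of the toric
Hermitian structure with conformal factor `Ω`. The Killing field `∂_τ` is
`ξ_a = J^b_a ∂_b Ω⁻¹`, and `V` is related to `Ω` by `Ω⁻¹ = (1/2) ρ V_ρ`. The coordinates `τ`, `y`
are local, on the set `ρ > 0` where the Killing fields are linearly independent. -/
structure IsTodPotential (J : EndField M) (Ω : M → ℝ) (a b : ℝ × ℝ) (ζ : M → ℝ) (c : ℝ)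
    (V : ℝ → ℝ → ℝ) : Prop where
  c_ne_zero : c ≠ 0
  harmonic : IsAxisymmetricHarmonic V
  killing : ∀ (p : M) (v : TangentSpace (𝓡 4) p),
    inner ℝ (fundField a p) v = dform (fun q => (Ω q)⁻¹) p (J p v)
  conformalFactor : ∀ p : M, 0 < weylRho a b p →
    (Ω p)⁻¹ = 1 / 2 * weylRho a b p * dRho V (weylRho a b p) (ζ p)
  todForm : ∃ H : ℝ → ℝ → ℝ, IsHarmonicConjugate V H ∧
    ∀ p : M, 0 < weylRho a b p → ∃ (U : Set M) (τ y : M → ℝ), IsOpen U ∧ p ∈ U ∧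
      (∀ q ∈ U, 0 < weylRho a b q) ∧ IsTodFormOn J a b ζ c V H τ y U

end Tod

end ToricInstanton

end

/-!
The function `u = Ω⁻¹ = ½ ρ V_ρ` is the flux of the axisymmetric harmonic function `V`. It is a
continuous, positive, torus-invariant function on all of `M`, hence a continuous positive function
on the closed half-plane `{ρ ≥ 0}`, which is the orbit space. Its boundary value `f(ζ) = u(0, ζ)` is
the coefficient of `log ρ²` in `V`, and everything follows once `f` is known to be affine on each
rod.

All computations use the coordinates `(t, s) = (ρ², ζ)` and `v(t, s) = V(ρ, ζ)`, so that `V` is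
harmonic when `4 (t v_t)_t + v_ss = 0`; the flux is `u = t v_t`, and solves `4 t u_tt + u_ss = 0`.

*The flux is affine on rods.* The Gram matrix of `(∂_τ, ∂_y)` is also continuous and invariant, and
by the Tod form its entries are `W⁻¹`, `F W⁻¹` and `F² W⁻¹ + W ρ²`, which therefore have limits at
the axis. In terms of `u` the Tod functions read `c W = u - 2 u² u_t / |∇u|²` and
`c F = u² u_s / |∇u|² - (½ t v_s + h)` with `|∇u|² = 4 t u_t² + u_s²` and `h` the harmonic conjugate
of `V`. If `∂_τ` does not vanish on the rod, then `W` and `F` have limits there, the latter a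
constant `F₀` since the kernel of the Gram matrix is constant. Solving for `u_s` gives
`u_s → f² / (k + c F₀)` at the axis, where `k` is the boundary value of `h`, so that `k' = 2 f`.
Hence `f' = f² / N` and `N' = 2 f` with `N = k + c F₀`, which makes `f'` constant
(`IsTodOn.affine_of_ne_zero`). If `∂_τ` vanishes on the rod, then `u_s → 0` and `f` is constant
(`IsTodOn.const_of_eq_zero`). Since only limits of `u_s` at the axis are used, no a priori
regularity of `f` is needed.

*Removable singularities.* If `f = m ζ + k` on the rod, then `V - (m ζ + k) log ρ²` is harmonic and
its flux vanishes on the rod. Comparison with the barrier `t ^ (3/4)` shows that such a flux is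
`O(t ^ (3/4))` (`IsFluxOn.isBigO_rpow`), and an interior gradient estimate, proved by doubling the
variable `s`, shows that its `s`-derivative vanishes on the axis too (`IsFluxOn.tendsto_d2`). So the
class of harmonic functions without flux is closed under `∂_s`. Its members are continuous up to the
axis, and since `∂_t (t ^ (j + 1) ∂_t ^ (j + 1) v) = -¼ t ^ j ∂_t ^ j v_ss`, the same follows for
all `t`-derivatives by induction: the function is smooth in `(ρ², ζ)` up to the axis
(`IsRegularOn.contDiffOn_extendFrom`). Its boundary value is `g`, and the rest is `O(ρ²)`.
-/

/-! ### Partial derivatives on a strip along the axis -/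

namespace ToricInstanton

open Set Filter

/-- The open half-strip `{(t, s) | 0 < t, s ∈ I}`. The first coordinate is `t = ρ²`. -/
abbrev strip (I : Set ℝ) : Set (ℝ × ℝ) := Ioi (0 : ℝ) ×ˢ I

/-- The filter of approach to the point `(0, s)` of the axis, from the side `t > 0`. -/
abbrev axisNhds (s : ℝ) : Filter (ℝ × ℝ) := 𝓝[>] (0 : ℝ) ×ˢ 𝓝 s

/-- The partial derivative in the first variable. -/
noncomputable def d1 (F : ℝ × ℝ → ℝ) (q : ℝ × ℝ) : ℝ := fderiv ℝ F q (1, 0)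

/-- The partial derivative in the second variable. -/
noncomputable def d2 (F : ℝ × ℝ → ℝ) (q : ℝ × ℝ) : ℝ := fderiv ℝ F q (0, 1)

variable {F G w : ℝ × ℝ → ℝ} {U : Set (ℝ × ℝ)} {I : Set ℝ} {t s : ℝ} {q : ℝ × ℝ}

lemma isOpen_strip (hI : IsOpen I) : IsOpen (strip I) := isOpen_Ioi.prod hI

lemma contDiffOn_d1 (hU : IsOpen U) (h : ContDiffOn ℝ ∞ F U) : ContDiffOn ℝ ∞ (d1 F) U :=
  (h.fderiv_of_isOpen hU (by simp)).clm_apply contDiffOn_const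

lemma contDiffOn_d2 (hU : IsOpen U) (h : ContDiffOn ℝ ∞ F U) : ContDiffOn ℝ ∞ (d2 F) U :=
  (h.fderiv_of_isOpen hU (by simp)).clm_apply contDiffOn_const

lemma differentiableAt_of_contDiffOn (hU : IsOpen U) (h : ContDiffOn ℝ ∞ F U) (hq : q ∈ U) :
    DifferentiableAt ℝ F q :=
  (h.contDiffAt (hU.mem_nhds hq)).differentiableAt (by simp)

lemma hasDerivAt_d1 (h : DifferentiableAt ℝ F (t, s)) :
    HasDerivAt (fun x => F (x, s)) (d1 F (t, s)) t := by
  have h1 : HasDerivAt (fun x : ℝ => (x, s)) ((1 : ℝ), (0 : ℝ)) t :=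
    (hasDerivAt_id t).prodMk (hasDerivAt_const t s)
  exact h.hasFDerivAt.comp_hasDerivAt t h1

lemma hasDerivAt_d2 (h : DifferentiableAt ℝ F (t, s)) :
    HasDerivAt (fun x => F (t, x)) (d2 F (t, s)) s := by
  have h1 : HasDerivAt (fun x : ℝ => (t, x)) ((0 : ℝ), (1 : ℝ)) s :=
    (hasDerivAt_const s t).prodMk (hasDerivAt_id s)
  exact h.hasFDerivAt.comp_hasDerivAt s h1

lemma hasFDerivAt_d1_d2 (h : DifferentiableAt ℝ F q) :
    HasFDerivAt F (d1 F q • ContinuousLinearMap.fst ℝ ℝ ℝ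
      + d2 F q • ContinuousLinearMap.snd ℝ ℝ ℝ) q := by
  convert h.hasFDerivAt using 1
  ext <;> simp [d1, d2]

lemma d1_congr (hU : IsOpen U) (h : EqOn F G U) : EqOn (d1 F) (d1 G) U := fun q hq => by
  simp only [d1, (h.eventuallyEq_of_mem (hU.mem_nhds hq)).fderiv_eq]

lemma d2_congr (hU : IsOpen U) (h : EqOn F G U) : EqOn (d2 F) (d2 G) U := fun q hq => by
  simp only [d2, (h.eventuallyEq_of_mem (hU.mem_nhds hq)).fderiv_eq]

lemma d1_d2_comm (hU : IsOpen U) (h : ContDiffOn ℝ ∞ F U) (hq : q ∈ U) :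
    d1 (d2 F) q = d2 (d1 F) q := by
  have h1 : DifferentiableAt ℝ (fderiv ℝ F) q :=
    ((h.fderiv_of_isOpen (m := ∞) hU (by simp)).contDiffAt (hU.mem_nhds hq)).differentiableAt
      (by simp)
  have h2 : IsSymmSndFDerivAt ℝ F q :=
    (h.contDiffAt (hU.mem_nhds hq)).isSymmSndFDerivAt
      (by simpa using (WithTop.coe_le_coe.2 (le_top : (2 : ℕ∞) ≤ ⊤)))
  have e1 : HasFDerivAt (d2 F) ((fderiv ℝ (fderiv ℝ F) q).flip (0, 1)) q := by
    have := h1.hasFDerivAt.clm_apply (hasFDerivAt_const ((0 : ℝ), (1 : ℝ)) q)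
    simp only [ContinuousLinearMap.comp_zero, zero_add] at this
    exact this
  have e2 : HasFDerivAt (d1 F) ((fderiv ℝ (fderiv ℝ F) q).flip (1, 0)) q := by
    have := h1.hasFDerivAt.clm_apply (hasFDerivAt_const ((1 : ℝ), (0 : ℝ)) q)
    simp only [ContinuousLinearMap.comp_zero, zero_add] at this
    exact this
  rw [d1, d2, e1.fderiv, e2.fderiv]
  exact h2 _ _

lemma eventually_axisNhds {P : ℝ × ℝ → Prop} {s₀ : ℝ} (h : ∀ᶠ q in axisNhds s₀, P q) :
    ∃ δ > 0, ∀ t s, 0 < t → t < δ → |s - s₀| < δ → P (t, s) := by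
  have hb := (nhdsGT_basis (0 : ℝ)).prod (Metric.nhds_basis_ball (x := s₀))
  obtain ⟨⟨a, b⟩, ⟨ha, hb'⟩, hP⟩ := hb.eventually_iff.1 h
  refine ⟨min a b, lt_min ha hb', fun t s h0 h1 h2 => hP ⟨⟨h0, h1.trans_le (min_le_left _ _)⟩, ?_⟩⟩
  simpa [Real.dist_eq] using h2.trans_le (min_le_right _ _)

lemma axisNhds_of_forall {P : ℝ × ℝ → Prop} {s₀ δ : ℝ} (hδ : 0 < δ)
    (h : ∀ t s, 0 < t → t < δ → |s - s₀| < δ → P (t, s)) : ∀ᶠ q in axisNhds s₀, P q := by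
  have hb := (nhdsGT_basis (0 : ℝ)).prod (Metric.nhds_basis_ball (x := s₀))
  refine hb.eventually_iff.2 ⟨(δ, δ), ⟨hδ, hδ⟩, ?_⟩
  rintro ⟨t, s⟩ ⟨h1, h2⟩
  exact h t s h1.1 h1.2 (by simpa [Real.dist_eq] using h2)

lemma axisNhds_mem_strip (hI : IsOpen I) (hs : s ∈ I) : strip I ∈ axisNhds s :=
  prod_mem_prod self_mem_nhdsWithin (hI.mem_nhds hs)

lemma nhdsWithin_strip (hI : IsOpen I) (hs : s ∈ I) : 𝓝[strip I] (0, s) = axisNhds s := by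
  rw [nhdsWithin_prod_eq, hI.nhdsWithin_eq hs]

/-! ### Maximum principle for `4 t w_tt + w_ss = 0` -/

/-- `w(t, s)` is smooth for `t > 0`, `s ∈ I` and solves `4 t w_tt + w_ss = 0`. In terms of
`ρ = √t` this is `w_ρρ - w_ρ / ρ + w_ss = 0`, the equation of `ρ V_ρ` for `V` axisymmetric and
harmonic. -/
structure IsFluxOn (w : ℝ × ℝ → ℝ) (I : Set ℝ) : Prop where
  smooth : ContDiffOn ℝ ∞ w (strip I)
  eq : ∀ q ∈ strip I, 4 * q.1 * d1 (d1 w) q + d2 (d2 w) q = 0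

lemma IsLocalMax.second_deriv_nonpos {f f' : ℝ → ℝ} {x f'' : ℝ} (hmax : IsLocalMax f x)
    (h1 : ∀ᶠ y in 𝓝 x, HasDerivAt f (f' y) y) (h2 : HasDerivAt f' f'' x) : f'' ≤ 0 := by
  by_contra! hpos
  have e1 : deriv f =ᶠ[𝓝 x] f' := h1.mono fun y hy => hy.deriv
  have e2 : deriv (deriv f) x = f'' := by rw [e1.deriv_eq, h2.deriv]
  have hmin : IsLocalMin f x :=
    isLocalMin_of_deriv_deriv_pos (e2 ▸ hpos) hmax.deriv_eq_zero h1.self_of_nhds.continuousAt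
  -- a local minimum that is a local maximum: the function is locally constant
  have hc : f =ᶠ[𝓝 x] fun _ => f x := by
    filter_upwards [hmax, hmin] with y hy hy' using le_antisymm hy hy'
  have e3 : deriv f =ᶠ[𝓝 x] fun _ => 0 := by
    filter_upwards [hc.eventuallyEq_nhds] with y hy
    rw [hy.deriv_eq, deriv_const]
  rw [e3.deriv_eq, deriv_const] at e2
  exact hpos.ne e2

lemma IsLocalMax.second_deriv_le {f f' : ℝ → ℝ} {x f'' α β γ : ℝ}
    (hmax : IsLocalMax (fun z => f z - (α * z ^ 2 + β * z + γ)) x)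
    (h1 : ∀ᶠ y in 𝓝 x, HasDerivAt f (f' y) y) (h2 : HasDerivAt f' f'' x) : f'' ≤ 2 * α := by
  have k1 (y : ℝ) : HasDerivAt (fun z => α * z ^ 2 + β * z + γ) (2 * α * y + β) y := by
    have := (((hasDerivAt_pow 2 y).const_mul α).add ((hasDerivAt_id y).const_mul β)).add_const γ
    refine this.congr_deriv ?_
    push_cast
    ring
  have k2 : HasDerivAt (fun z => 2 * α * z + β) (2 * α) x := by
    simpa using ((hasDerivAt_id x).const_mul (2 * α)).add_const β
  have := IsLocalMax.second_deriv_nonpos hmax (h1.mono fun y hy => hy.sub (k1 y)) (h2.sub k2)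
  linarith

set_option maxHeartbeats 800000 in
/-- One half of the interior gradient estimate: comparison in the doubled variables
`(t, a, b)`, in which `w (t, a) - w (t, b)` solves `4 t ∂_t² + ∂_a² + ∂_b² = 0`. -/
lemma IsFluxOn.sub_le (hI : IsOpen I) (hw : IsFluxOn w I) {t₀ s₀ d M : ℝ} (ht : 0 < t₀)
    (hd : 0 < d) (hdt : d ^ 2 ≤ t₀) (hM : 0 < M) (hsub : Icc (s₀ - d) (s₀ + d) ⊆ I)
    (hb : ∀ t s, |t - t₀| ≤ t₀ / 2 → |s - s₀| ≤ d → |w (t, s)| ≤ M) {a b : ℝ}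
    (ha : |a - s₀| ≤ d) (hb' : |b - s₀| ≤ d) (hab : b ≤ a) :
    w (t₀, a) - w (t₀, b) ≤ 2 * M / d ^ 2 *
      ((a - s₀) ^ 2 + (b - s₀) ^ 2 + 14 * ((a - b) * (2 * d - (a - b)))) := by
  -- The quadratic terms make `B ≥ 2 M` on the outer sides of the box. On `x.2.1 = x.2.2`, where the
  -- difference of the values of `w` vanishes, `B ≥ 0`. The weight `14` makes `B` a strict
  -- supersolution. At the points `(t₀, s₀ + η, s₀ - η)` it is `O(η)`, which bounds the derivative.
  set B : ℝ × ℝ × ℝ → ℝ := fun x => 2 * M / d ^ 2 * (4 * d ^ 2 / t₀ ^ 2 * (x.1 - t₀) ^ 2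
    + (x.2.1 - s₀) ^ 2 + (x.2.2 - s₀) ^ 2
    + 14 * ((x.2.1 - x.2.2) * (2 * d - (x.2.1 - x.2.2)))) with hB
  set Ψ : ℝ × ℝ × ℝ → ℝ := fun x => w (x.1, x.2.1) - w (x.1, x.2.2) - B x with hΨ
  set K : Set (ℝ × ℝ × ℝ) := (Icc (t₀ / 2) (3 * t₀ / 2) ×ˢ Icc (s₀ - d) (s₀ + d) ×ˢ
    Icc (s₀ - d) (s₀ + d)) ∩ {x | x.2.2 ≤ x.2.1} with hK
  have hKc : IsCompact K := (isCompact_Icc.prod (isCompact_Icc.prod isCompact_Icc)).inter_right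
    (isClosed_le (by fun_prop) (by fun_prop))
  have hmem : (t₀, a, b) ∈ K := by
    rw [abs_le] at ha hb'
    refine ⟨⟨⟨by dsimp; linarith, by dsimp; linarith⟩, ⟨by dsimp; linarith, by dsimp; linarith⟩,
      ⟨by dsimp; linarith, by dsimp; linarith⟩⟩, hab⟩
  have hwc : ContinuousOn w (strip I) := hw.smooth.continuousOn
  have hΨc : ContinuousOn Ψ K := by
    have h1 : ContinuousOn (fun x : ℝ × ℝ × ℝ => w (x.1, x.2.1)) K :=
      hwc.comp (by fun_prop) fun x hx => ⟨by have := hx.1.1.1; simp; linarith, hsub hx.1.2.1⟩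
    have h2 : ContinuousOn (fun x : ℝ × ℝ × ℝ => w (x.1, x.2.2)) K :=
      hwc.comp (by fun_prop) fun x hx => ⟨by have := hx.1.1.1; simp; linarith, hsub hx.1.2.2⟩
    exact (h1.sub h2).sub (by fun_prop)
  obtain ⟨⟨t, x, y⟩, hxK, hmax⟩ := hKc.exists_isMaxOn ⟨_, hmem⟩ hΨc
  suffices h : Ψ (t, x, y) ≤ 0 by
    have := (hmax hmem).trans h
    simp only [hΨ, hB] at this
    simpa using this
  by_contra! hpos
  obtain ⟨⟨⟨ht1, ht2⟩, ⟨hx1, hx2⟩, ⟨hy1, hy2⟩⟩, hyx⟩ := hxK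
  dsimp at ht1 ht2 hx1 hx2 hy1 hy2 hyx
  have hd2 : 0 < d ^ 2 := by positivity
  have hMd : 0 < 2 * M / d ^ 2 := by positivity
  have hw2 : w (t, x) - w (t, y) ≤ 2 * M := by
    have h1 := abs_le.1 (hb t x (abs_le.2 ⟨by linarith, by linarith⟩)
      (abs_le.2 ⟨by linarith, by linarith⟩))
    have h2 := abs_le.1 (hb t y (abs_le.2 ⟨by linarith, by linarith⟩)
      (abs_le.2 ⟨by linarith, by linarith⟩))
    linarith [h1.2, h2.1]
  -- on the part of the boundary off the diagonal the barrier dominates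
  have hlt : 4 * d ^ 2 / t₀ ^ 2 * (t - t₀) ^ 2 + (x - s₀) ^ 2 + (y - s₀) ^ 2
      + 14 * ((x - y) * (2 * d - (x - y))) < d ^ 2 := by
    have : 2 * M / d ^ 2 * (4 * d ^ 2 / t₀ ^ 2 * (t - t₀) ^ 2 + (x - s₀) ^ 2 + (y - s₀) ^ 2
      + 14 * ((x - y) * (2 * d - (x - y)))) < 2 * M / d ^ 2 * d ^ 2 := by
      have e : 2 * M / d ^ 2 * d ^ 2 = 2 * M := by field_simp
      simp only [hΨ, hB] at hpos
      rw [e]; linarith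
    exact lt_of_mul_lt_mul_left this hMd.le
  have hprod : 0 ≤ (x - y) * (2 * d - (x - y)) :=
    mul_nonneg (by linarith) (by linarith)
  have hT : 0 ≤ 4 * d ^ 2 / t₀ ^ 2 * (t - t₀) ^ 2 := by positivity
  have hxy : y < x := by
    refine lt_of_le_of_ne hyx fun h => ?_
    subst h
    simp only [hΨ, hB, sub_self] at hpos
    have : 0 ≤ 2 * M / d ^ 2 * (4 * d ^ 2 / t₀ ^ 2 * (t - t₀) ^ 2 + (y - s₀) ^ 2 + (y - s₀) ^ 2
      + 14 * (0 * (2 * d - 0))) := by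
      simp only [zero_mul, mul_zero, add_zero]
      positivity
    linarith
  have hxd : |x - s₀| < d := abs_lt_of_sq_lt_sq (by nlinarith [sq_nonneg (y - s₀)]) hd.le
  have hyd : |y - s₀| < d := abs_lt_of_sq_lt_sq (by nlinarith [sq_nonneg (x - s₀)]) hd.le
  have htd : |t - t₀| < t₀ / 2 := by
    refine abs_lt_of_sq_lt_sq ?_ (by positivity)
    have h1 : 4 * d ^ 2 / t₀ ^ 2 * (t - t₀) ^ 2 < d ^ 2 := by
      nlinarith [sq_nonneg (x - s₀), sq_nonneg (y - s₀)]
    have h2 : 4 * d ^ 2 / t₀ ^ 2 * (t - t₀) ^ 2 = d ^ 2 * ((t - t₀) ^ 2 / (t₀ / 2) ^ 2) := by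
      field_simp; ring
    rw [h2] at h1
    have h3 : (t - t₀) ^ 2 / (t₀ / 2) ^ 2 < 1 := by
      by_contra! h; nlinarith
    rwa [div_lt_one (by positivity)] at h3
  rw [abs_lt] at hxd hyd htd
  have htpos : 0 < t := by linarith
  have hxI : x ∈ I := hsub ⟨hx1, hx2⟩
  have hyI : y ∈ I := hsub ⟨hy1, hy2⟩
  have hUo := isOpen_strip hI
  have hs1 := contDiffOn_d1 hUo hw.smooth
  have hs2 := contDiffOn_d2 hUo hw.smooth
  have D {F : ℝ × ℝ → ℝ} (h : ContDiffOn ℝ ∞ F (strip I)) {t s : ℝ} (h1 : 0 < t) (h2 : s ∈ I) :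
    DifferentiableAt ℝ F (t, s) := differentiableAt_of_contDiffOn hUo h ⟨h1, h2⟩
  have hloc : ∀ᶠ z in 𝓝 (t, x, y), Ψ z ≤ Ψ (t, x, y) := by
    have hn : K ∈ 𝓝 (t, x, y) := by
      refine inter_mem (prod_mem_nhds (Icc_mem_nhds (by linarith) (by linarith))
        (prod_mem_nhds (Icc_mem_nhds (by linarith) (by linarith))
        (Icc_mem_nhds (by linarith) (by linarith)))) ?_
      filter_upwards [(isOpen_lt (by fun_prop) (by fun_prop) :
        IsOpen {x : ℝ × ℝ × ℝ | x.2.2 < x.2.1}).mem_nhds hxy] with z hz using le_of_lt hz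
    filter_upwards [hn] with z hz using hmax hz
  set k : ℝ := 2 * M / d ^ 2 with hk
  set l : ℝ := 4 * d ^ 2 / t₀ ^ 2 with hl
  have m1 : d1 (d1 w) (t, x) - d1 (d1 w) (t, y) ≤ 2 * (k * l) := by
    refine IsLocalMax.second_deriv_le (f := fun t' => w (t', x) - w (t', y)) (x := t)
      (f' := fun t' => d1 w (t', x) - d1 w (t', y)) (β := k * l * (-2 * t₀))
      (γ := k * (l * t₀ ^ 2 + (x - s₀) ^ 2 + (y - s₀) ^ 2
        + 14 * ((x - y) * (2 * d - (x - y))))) ?_ ?_ ?_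
    · filter_upwards [(by fun_prop : ContinuousAt (fun t' : ℝ => (t', x, y)) t).eventually hloc]
        with t' h
      simp only [hΨ, hB] at h
      linear_combination h
    · filter_upwards [lt_mem_nhds htpos] with t' ht'
      exact (hasDerivAt_d1 (D hw.smooth ht' hxI)).sub (hasDerivAt_d1 (D hw.smooth ht' hyI))
    · exact (hasDerivAt_d1 (D hs1 htpos hxI)).sub (hasDerivAt_d1 (D hs1 htpos hyI))
  have m2 : d2 (d2 w) (t, x) ≤ 2 * (-13 * k) := by
    refine IsLocalMax.second_deriv_le (f := fun x' => w (t, x')) (x := x)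
      (f' := fun x' => d2 w (t, x')) (β := k * (-2 * s₀ + 14 * (2 * d + 2 * y)))
      (γ := k * (l * (t - t₀) ^ 2 + s₀ ^ 2 + (y - s₀) ^ 2 - 14 * (2 * d * y + y ^ 2)))
      ?_ ?_ (hasDerivAt_d2 (D hs2 htpos hxI))
    · filter_upwards [(by fun_prop : ContinuousAt (fun x' : ℝ => (t, x', y)) x).eventually hloc]
        with x' h
      simp only [hΨ, hB] at h
      linear_combination h
    · filter_upwards [hI.mem_nhds hxI] with x' hx' using hasDerivAt_d2 (D hw.smooth htpos hx')
  have m3 : - d2 (d2 w) (t, y) ≤ 2 * (-13 * k) := by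
    refine IsLocalMax.second_deriv_le (f := fun y' => -w (t, y')) (x := y)
      (f' := fun y' => -d2 w (t, y')) (β := k * (-2 * s₀ + 14 * (2 * x - 2 * d)))
      (γ := k * (l * (t - t₀) ^ 2 + s₀ ^ 2 + (x - s₀) ^ 2 + 14 * (2 * d * x - x ^ 2)))
      ?_ ?_ (hasDerivAt_d2 (D hs2 htpos hyI)).neg
    · filter_upwards [(by fun_prop : ContinuousAt (fun y' : ℝ => (t, x, y')) y).eventually hloc]
        with y' h
      simp only [hΨ, hB] at h
      linear_combination h
    · filter_upwards [hI.mem_nhds hyI] with y' hy' using (hasDerivAt_d2 (D hw.smooth htpos hy')).neg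
  have e1 := hw.eq (t, x) ⟨htpos, hxI⟩
  have e2 := hw.eq (t, y) ⟨htpos, hyI⟩
  dsimp at e1 e2
  have key : 4 * t * (2 * l) ≤ 48 := by
    have h1 : 4 * t * (2 * l) = 32 * (t * d ^ 2) / t₀ ^ 2 := by rw [hl]; ring
    rw [h1, div_le_iff₀ (by positivity)]
    have : t * d ^ 2 ≤ (3 * t₀ / 2) * t₀ := mul_le_mul ht2 hdt hd2.le (by positivity)
    nlinarith
  have m1' := mul_le_mul_of_nonneg_left m1 (by positivity : 0 ≤ 4 * t)
  have key' := mul_le_mul_of_nonneg_left key hMd.le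
  linarith only [m1', key', m2, m3, e1, e2, hMd]

lemma deriv_abs_le_of_symm {f : ℝ → ℝ} {x f' C δ : ℝ} (hf : HasDerivAt f f' x) (hδ : 0 < δ)
    (h : ∀ η, 0 < η → η < δ → |f (x + η) - f (x - η)| ≤ 2 * C * η) : |f'| ≤ C := by
  have h1 : HasDerivAt (fun η => f (x + η)) f' 0 := by
    simpa using (HasDerivAt.comp_const_add x 0 (by simpa using hf))
  have h2 : HasDerivAt (fun η => f (x - η)) (-f') 0 := by
    simpa using (HasDerivAt.comp_const_sub x 0 (by simpa using hf))
  have h3 : Tendsto (slope (fun η => f (x + η) - f (x - η)) 0) (𝓝[>] 0) (𝓝 (f' - -f')) :=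
    (hasDerivAt_iff_tendsto_slope.1 (h1.sub h2)).mono_left
      (nhdsWithin_mono _ fun y hy => ne_of_gt hy)
  have h4 : |f' - -f'| ≤ 2 * C := by
    refine le_of_tendsto h3.abs ?_
    filter_upwards [Ioo_mem_nhdsGT hδ] with η hη
    rw [slope_def_field]
    simp only [add_zero, sub_zero, sub_self]
    rw [abs_div, abs_of_pos hη.1, div_le_iff₀ hη.1]
    exact h η hη.1 hη.2
  rw [show f' - -f' = 2 * f' by ring, abs_mul, abs_two] at h4
  linarith

lemma IsFluxOn.neg (hw : IsFluxOn w I) : IsFluxOn (-w) I where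
  smooth := hw.smooth.neg
  eq q hq := by
    have e1 : d1 (-w) = -d1 w := by funext; simp [d1, fderiv_neg]
    have e2 : d2 (-w) = -d2 w := by funext; simp [d2, fderiv_neg]
    have e3 : d1 (-d1 w) = -d1 (d1 w) := by funext; simp [d1, fderiv_neg]
    have e4 : d2 (-d2 w) = -d2 (d2 w) := by funext; simp [d2, fderiv_neg]
    rw [e1, e2, e3, e4]
    have := hw.eq q hq
    simp only [Pi.neg_apply]
    linarith

/-- Interior gradient estimate for `w_s`, on the scale `√t` that is natural for the equation. -/
lemma IsFluxOn.abs_d2_le (hI : IsOpen I) (hw : IsFluxOn w I) {t₀ s₀ d M : ℝ} (ht : 0 < t₀)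
    (hd : 0 < d) (hdt : d ^ 2 ≤ t₀) (hM : 0 < M) (hsub : Icc (s₀ - d) (s₀ + d) ⊆ I)
    (hb : ∀ t s, |t - t₀| ≤ t₀ / 2 → |s - s₀| ≤ d → |w (t, s)| ≤ M) :
    |d2 w (t₀, s₀)| ≤ 56 * M / d := by
  have hs : s₀ ∈ I := hsub ⟨by linarith, by linarith⟩
  refine deriv_abs_le_of_symm (hasDerivAt_d2 (differentiableAt_of_contDiffOn (isOpen_strip hI)
    hw.smooth ⟨ht, hs⟩)) hd fun η h0 h1 => ?_
  have ha : |s₀ + η - s₀| ≤ d := by rw [add_sub_cancel_left, abs_of_pos h0]; exact h1.le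
  have hb' : |s₀ - η - s₀| ≤ d := by
    rw [show s₀ - η - s₀ = -η by ring, abs_neg, abs_of_pos h0]; exact h1.le
  have k1 := hw.sub_le hI ht hd hdt hM hsub hb ha hb' (by linarith)
  have k2 := (hw.neg).sub_le hI ht hd hdt hM hsub (by simpa using hb) ha hb' (by linarith)
  have k3 : 2 * M / d ^ 2 * ((s₀ + η - s₀) ^ 2 + (s₀ - η - s₀) ^ 2
      + 14 * ((s₀ + η - (s₀ - η)) * (2 * d - (s₀ + η - (s₀ - η))))) ≤ 2 * (56 * M / d) * η := by
    have : 2 * (56 * M / d) * η = 2 * M / d ^ 2 * (56 * d * η) := by field_simp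
    rw [this]
    gcongr
    nlinarith [sq_nonneg η]
  simp only [Pi.neg_apply] at k2
  rw [abs_le]
  constructor <;> linarith

end ToricInstanton

namespace ToricInstanton

open Set Filter

variable {F G w v : ℝ × ℝ → ℝ} {U : Set (ℝ × ℝ)} {I : Set ℝ} {t s s₀ : ℝ} {q : ℝ × ℝ}

/-! ### Decay of a flux that vanishes on the axis -/

lemma hasDerivAt_rpow_of_pos {x p p' : ℝ} (hx : 0 < x) (h : p' = p - 1) :
    HasDerivAt (fun x => x ^ p) (p * x ^ p') x := by
  rw [h]
  exact Real.hasDerivAt_rpow_const (Or.inl hx.ne')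

/-- Comparison with the barrier `(s - s₁)² / d² + C t ^ (3/4)`. The power `3/4` is concave enough
for the barrier to be a strict supersolution, and large enough (more than `1/2`) for the interior
gradient estimate to give `w_s → 0`. -/
lemma IsFluxOn.le_rpow (hI : IsOpen I) (hw : IsFluxOn w I) {s₁ d M : ℝ}
    (hd : 0 < d) (hM : 0 < M) (hsub : Icc (s₁ - d) (s₁ + d) ⊆ I)
    (hlim : ∀ s ∈ I, Tendsto w (axisNhds s) (𝓝 0))
    (hb : ∀ t s, 0 < t → t ≤ 1 → |s - s₁| ≤ d → w (t, s) ≤ M) (ht : 0 < t) (ht1 : t ≤ 1) :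
    w (t, s₁) ≤ M * (1 + 3 / d ^ 2) * t ^ (3 / 4 : ℝ) := by
  set C := 1 + 3 / d ^ 2 with hC
  have hC0 : 0 < C := by positivity
  set W : ℝ × ℝ → ℝ := fun q => if 0 < q.1 then w q else 0 with hW
  set Ψ : ℝ × ℝ → ℝ := fun q => W q - M * ((q.2 - s₁) ^ 2 / d ^ 2 + C * q.1 ^ (3 / 4 : ℝ)) with hΨ
  set K : Set (ℝ × ℝ) := Icc 0 1 ×ˢ Icc (s₁ - d) (s₁ + d) with hK
  have hKc : IsCompact K := isCompact_Icc.prod isCompact_Icc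
  have hmem : (t, s₁) ∈ K := ⟨⟨ht.le, ht1⟩, ⟨by dsimp; linarith, by dsimp; linarith⟩⟩
  have hWc : ContinuousOn W K := by
    rintro ⟨x, y⟩ ⟨⟨hx0, hx1⟩, hy⟩
    have hyI : y ∈ I := hsub hy
    dsimp at hx0
    rcases hx0.eq_or_lt with rfl | hx0
    · have hcov : K ⊆ strip I ∪ {q | q.1 = 0} := by
        rintro ⟨x, y⟩ ⟨⟨hx0, -⟩, hy⟩
        dsimp at hx0
        rcases hx0.eq_or_lt with h | h
        · exact Or.inr h.symm
        · exact Or.inl ⟨h, hsub hy⟩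
      refine ContinuousWithinAt.mono ?_ hcov
      refine ContinuousWithinAt.union ?_ ?_
      · have h0 : W (0, y) = 0 := by simp [hW]
        rw [ContinuousWithinAt, h0, nhdsWithin_strip hI hyI]
        refine (hlim y hyI).congr' ?_
        filter_upwards [axisNhds_mem_strip hI hyI] with q hq
        simp only [hW]
        rw [if_pos (show 0 < q.1 from hq.1)]
      · refine (continuousWithinAt_const (b := (0 : ℝ))).congr (fun q hq => ?_) (by simp [hW])
        have : q.1 = 0 := hq
        simp [hW, this]
    · have h1 : ContinuousAt w (x, y) :=
        hw.smooth.continuousOn.continuousAt ((isOpen_strip hI).mem_nhds ⟨hx0, hyI⟩)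
      refine (h1.congr ?_).continuousWithinAt
      filter_upwards [(isOpen_strip hI).mem_nhds (show (x, y) ∈ strip I from ⟨hx0, hyI⟩)] with q hq
      simp only [hW]
      rw [if_pos (show 0 < q.1 from hq.1)]
  have hΨc : ContinuousOn Ψ K := by
    refine hWc.sub (Continuous.continuousOn ?_)
    have : Continuous fun q : ℝ × ℝ => q.1 ^ (3 / 4 : ℝ) :=
      continuous_fst.rpow_const fun _ => Or.inr (by norm_num)
    fun_prop
  obtain ⟨⟨x, y⟩, ⟨⟨hx0, hx1⟩, ⟨hy1, hy2⟩⟩, hmax⟩ := hKc.exists_isMaxOn ⟨_, hmem⟩ hΨc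
  dsimp at hx0 hx1 hy1 hy2
  suffices h : Ψ (x, y) ≤ 0 by
    have := (hmax hmem).trans h
    simp only [hΨ, hW, ht, if_true] at this
    have e : M * ((s₁ - s₁) ^ 2 / d ^ 2 + C * t ^ (3 / 4 : ℝ)) = M * C * t ^ (3 / 4 : ℝ) := by
      ring
    linarith
  by_contra! hpos
  have hxpos : 0 < x := by
    refine lt_of_le_of_ne hx0 fun h => ?_
    subst h
    simp only [hΨ, hW, lt_irrefl, if_false] at hpos
    have : 0 ≤ M * ((y - s₁) ^ 2 / d ^ 2 + C * (0 : ℝ) ^ (3 / 4 : ℝ)) := by positivity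
    linarith
  have hyI : y ∈ I := hsub ⟨hy1, hy2⟩
  have hpos' : (y - s₁) ^ 2 / d ^ 2 + C * x ^ (3 / 4 : ℝ) < 1 := by
    simp only [hΨ, hW, hxpos, if_true] at hpos
    have := hb x y hxpos hx1 (abs_le.2 ⟨by linarith, by linarith⟩)
    by_contra! h
    nlinarith
  have hx34 : 0 < x ^ (3 / 4 : ℝ) := by positivity
  have hsq : 0 ≤ (y - s₁) ^ 2 / d ^ 2 := by positivity
  have hxlt : x < 1 := by
    refine lt_of_le_of_ne hx1 fun h => ?_
    subst h
    rw [Real.one_rpow] at hpos'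
    have : 0 < 3 / d ^ 2 := by positivity
    linarith
  have hyd : |y - s₁| < d := by
    refine abs_lt_of_sq_lt_sq ?_ hd.le
    rw [← div_lt_one (by positivity)]
    have : 0 < C * x ^ (3 / 4 : ℝ) := by positivity
    linarith
  rw [abs_lt] at hyd
  have hloc : ∀ᶠ z in 𝓝 (x, y), Ψ z ≤ Ψ (x, y) := by
    have hn : K ∈ 𝓝 (x, y) :=
      prod_mem_nhds (Icc_mem_nhds hxpos hxlt) (Icc_mem_nhds (by linarith) (by linarith))
    filter_upwards [hn] with z hz using hmax hz
  have hUo := isOpen_strip hI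
  have D {F : ℝ × ℝ → ℝ} (h : ContDiffOn ℝ ∞ F (strip I)) {t s : ℝ} (h1 : 0 < t) (h2 : s ∈ I) :
    DifferentiableAt ℝ F (t, s) := differentiableAt_of_contDiffOn hUo h ⟨h1, h2⟩
  have m1 : d1 (d1 w) (x, y) - M * (C * (3 / 4 * ((-1 / 4) * x ^ (-5 / 4 : ℝ)))) ≤ 0 := by
    refine IsLocalMax.second_deriv_nonpos (f := fun x' => w (x', y) - M * (C * x' ^ (3 / 4 : ℝ)))
      (x := x) (f' := fun x' => d1 w (x', y) - M * (C * (3 / 4 * x' ^ (-1 / 4 : ℝ)))) ?_ ?_ ?_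
    · filter_upwards [(by fun_prop : ContinuousAt (fun x' : ℝ => (x', y)) x).eventually hloc,
        lt_mem_nhds hxpos] with x' h hx'
      simp only [hΨ, hW, hx', hxpos, if_true] at h
      linear_combination h
    · filter_upwards [lt_mem_nhds hxpos] with x' hx'
      refine (hasDerivAt_d1 (D hw.smooth hx' hyI)).sub
        (((hasDerivAt_rpow_of_pos hx' (by norm_num)).const_mul C).const_mul M)
    · refine (hasDerivAt_d1 (D (contDiffOn_d1 hUo hw.smooth) hxpos hyI)).sub
        ((((hasDerivAt_rpow_of_pos hxpos (by norm_num)).const_mul (3 / 4)).const_mul C).const_mul M)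
  have m2 : d2 (d2 w) (x, y) ≤ 2 * (M / d ^ 2) := by
    refine IsLocalMax.second_deriv_le (f := fun y' => w (x, y')) (x := y)
      (f' := fun y' => d2 w (x, y')) (β := M / d ^ 2 * (-2 * s₁))
      (γ := M / d ^ 2 * s₁ ^ 2 + M * (C * x ^ (3 / 4 : ℝ)))
      ?_ ?_ (hasDerivAt_d2 (D (contDiffOn_d2 hUo hw.smooth) hxpos hyI))
    · filter_upwards [(by fun_prop : ContinuousAt (fun y' : ℝ => (x, y')) y).eventually hloc]
        with y' h
      simp only [hΨ, hW, hxpos, if_true] at h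
      linear_combination h
    · filter_upwards [hI.mem_nhds hyI] with y' hy' using hasDerivAt_d2 (D hw.smooth hxpos hy')
  have e := hw.eq (x, y) ⟨hxpos, hyI⟩
  dsimp at e
  have hx1' : 1 ≤ x * x ^ (-5 / 4 : ℝ) := by
    have : x * x ^ (-5 / 4 : ℝ) = x ^ (-1 / 4 : ℝ) := by
      nth_rewrite 1 [← Real.rpow_one x]
      rw [← Real.rpow_add hxpos]; norm_num
    rw [this]
    exact Real.one_le_rpow_of_pos_of_le_one_of_nonpos hxpos hx1 (by norm_num)
  have m1' := mul_le_mul_of_nonneg_left m1 (by positivity : 0 ≤ 4 * x)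
  have h3 : M * (3 / d ^ 2) ≤ M * C * (x * x ^ (-5 / 4 : ℝ)) := by
    calc M * (3 / d ^ 2) ≤ M * C := by gcongr; rw [hC]; linarith
      _ ≤ _ := le_mul_of_one_le_right (by positivity) hx1'
  have h4 : 0 < M / d ^ 2 := by positivity
  have h5 : M * (3 / d ^ 2) = 3 * (M / d ^ 2) := by ring
  linarith

/-- A flux that vanishes on the axis is `O(t ^ (3/4))`, locally uniformly. -/
lemma IsFluxOn.isBigO_rpow (hI : IsOpen I) (hw : IsFluxOn w I)
    (hlim : ∀ s ∈ I, Tendsto w (axisNhds s) (𝓝 0)) (hs : s₀ ∈ I) :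
    ∃ C, ∀ᶠ q in axisNhds s₀, |w q| ≤ C * q.1 ^ (3 / 4 : ℝ) := by
  obtain ⟨ε, hε, hball⟩ := Metric.nhds_basis_closedBall.mem_iff.1 (hI.mem_nhds hs)
  rw [Real.closedBall_eq_Icc] at hball
  set d := ε / 2 with hd
  have hd0 : 0 < d := by positivity
  -- `w` is bounded on the closed rectangle, by compactness of its side on the axis
  obtain ⟨M, hM, hMb⟩ : ∃ M > 0, ∀ t s, 0 < t → t ≤ 1 → |s - s₀| ≤ ε → |w (t, s)| ≤ M := by
    have hcpt : IsCompact (Icc (0 : ℝ) 1 ×ˢ Icc (s₀ - ε) (s₀ + ε)) :=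
      isCompact_Icc.prod isCompact_Icc
    have hloc : ∀ q ∈ Icc (0 : ℝ) 1 ×ˢ Icc (s₀ - ε) (s₀ + ε), ∃ U ∈ 𝓝 q,
        ∃ M, ∀ p ∈ U, 0 < p.1 → |w p| ≤ M := by
      rintro ⟨x, y⟩ ⟨⟨hx0, -⟩, hy⟩
      have hyI : y ∈ I := hball hy
      dsimp at hx0
      rcases hx0.eq_or_lt with rfl | hx0
      · have h1 : ∀ᶠ q in axisNhds y, |w q| < 1 :=
          (hlim y hyI).abs.eventually (gt_mem_nhds (by simp))
        rw [← nhdsWithin_strip hI hyI, eventually_nhdsWithin_iff] at h1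
        refine ⟨_, inter_mem h1 (prod_mem_nhds univ_mem (hI.mem_nhds hyI)), 1, ?_⟩
        rintro p ⟨hp1, hp2⟩ hp
        exact (hp1 ⟨hp, hp2.2⟩).le
      · have h1 : ContinuousAt w (x, y) :=
          hw.smooth.continuousOn.continuousAt ((isOpen_strip hI).mem_nhds ⟨hx0, hyI⟩)
        refine ⟨_, h1.abs.eventually (gt_mem_nhds (lt_add_one _)), |w (x, y)| + 1, ?_⟩
        intro p hp _
        exact le_of_lt hp
    choose! U hU M hM using hloc
    obtain ⟨T, hT, hcov⟩ := hcpt.elim_nhds_subcover U hU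
    refine ⟨1 + ∑ q ∈ T, |M q|, by positivity, fun t s h0 h1 h2 => ?_⟩
    have hmem : (t, s) ∈ Icc (0 : ℝ) 1 ×ˢ Icc (s₀ - ε) (s₀ + ε) := by
      rw [abs_le] at h2
      exact ⟨⟨h0.le, h1⟩, ⟨by dsimp; linarith, by dsimp; linarith⟩⟩
    obtain ⟨q, hq, hqU⟩ := mem_iUnion₂.1 (hcov hmem)
    have := Finset.single_le_sum (f := fun q => |M q|) (fun q _ => abs_nonneg _) hq
    have h3 := hM q (hT q hq) _ hqU h0
    have := le_abs_self (M q)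
    linarith
  refine ⟨M * (1 + 3 / d ^ 2), axisNhds_of_forall (δ := min 1 d) (by positivity) ?_⟩
  intro t s h0 h1 h2
  have h1' : t ≤ 1 := h1.le.trans (min_le_left _ _)
  have h2' : |s - s₀| < d := h2.trans_le (min_le_right _ _)
  rw [abs_lt] at h2'
  have hsub : Icc (s - d) (s + d) ⊆ I := fun x hx =>
    hball ⟨by linarith [hx.1], by linarith [hx.2]⟩
  have hb : ∀ t' s', 0 < t' → t' ≤ 1 → |s' - s| ≤ d → |w (t', s')| ≤ M := fun t' s' h0 h1 h2 => by
    rw [abs_le] at h2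
    exact hMb t' s' h0 h1 (abs_le.2 ⟨by linarith, by linarith⟩)
  rw [abs_le]
  have k1 := hw.le_rpow hI hd0 hM hsub hlim (fun t' s' a b c => (abs_le.1 (hb t' s' a b c)).2)
    h0 h1'
  have k2 := hw.neg.le_rpow hI hd0 hM hsub
    (fun s hs => by have := (hlim s hs).neg; rwa [neg_zero] at this)
    (fun t' s' a b c => by
      have := (abs_le.1 (hb t' s' a b c)).1
      simp only [Pi.neg_apply]
      linarith)
    h0 h1'
  simp only [Pi.neg_apply] at k2
  exact ⟨by linarith, k1⟩

/-- The interior gradient estimate near the axis: differentiating in `s` costs a factor `√t`. -/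
lemma IsFluxOn.d2_isBigO (hI : IsOpen I) (hw : IsFluxOn w I) (hs : s₀ ∈ I) {C α : ℝ}
    (hα : 0 ≤ α) (hα1 : α ≤ 1) (hb : ∀ᶠ q in axisNhds s₀, |w q| ≤ C * q.1 ^ α) :
    ∃ C', ∀ᶠ q in axisNhds s₀, |d2 w q| ≤ C' * q.1 ^ (α - 1 / 2) := by
  obtain ⟨δ, hδ, h⟩ := eventually_axisNhds (hb.and (axisNhds_mem_strip hI hs))
  refine ⟨56 * (2 * (|C| + 1)), axisNhds_of_forall (δ := min (δ / 2) ((δ / 2) ^ 2))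
    (by positivity) ?_⟩
  intro t s h0 h1 h2
  have ht1 : t < δ / 2 := h1.trans_le (min_le_left _ _)
  have ht2 : √t < δ / 2 := by
    rw [Real.sqrt_lt' (by positivity)]
    exact h1.trans_le (min_le_right _ _)
  have hs2 : |s - s₀| < δ / 2 := h2.trans_le (min_le_left _ _)
  rw [abs_lt] at hs2
  have hp : 0 < t ^ α := by positivity
  have hsq : 0 < √t := Real.sqrt_pos.2 h0
  have key := hw.abs_d2_le hI h0 hsq (Real.sq_sqrt h0.le).le (M := 2 * (|C| + 1) * t ^ α)
    (by positivity) (fun x hx => ?_) (s₀ := s) (fun t' s' ht' hs' => ?_)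
  · refine key.trans (le_of_eq ?_)
    rw [Real.rpow_sub h0, ← Real.sqrt_eq_rpow]
    ring
  · exact (h t x h0 (by linarith) (abs_lt.2 ⟨by linarith [hx.1], by linarith [hx.2]⟩)).2.2
  · rw [abs_le] at ht' hs'
    have ht0 : 0 < t' := by linarith
    refine (h t' s' ht0 (by linarith) (abs_lt.2 ⟨by linarith, by linarith⟩)).1.trans ?_
    have e1 : t' ^ α ≤ 2 * t ^ α := by
      calc t' ^ α ≤ (2 * t) ^ α := Real.rpow_le_rpow ht0.le (by linarith) hα
        _ = 2 ^ α * t ^ α := Real.mul_rpow (by norm_num) h0.le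
        _ ≤ 2 ^ (1 : ℝ) * t ^ α := by gcongr; norm_num
        _ = _ := by rw [Real.rpow_one]
    have e2 : 0 < t' ^ α := by positivity
    dsimp
    calc C * t' ^ α ≤ (|C| + 1) * t' ^ α := by gcongr; linarith [le_abs_self C]
      _ ≤ (|C| + 1) * (2 * t ^ α) := by gcongr
      _ = _ := by ring

lemma tendsto_rpow_axis {α : ℝ} (hα : 0 < α) :
    Tendsto (fun q : ℝ × ℝ => q.1 ^ α) (axisNhds s₀) (𝓝 0) := by
  have h1 : Tendsto (fun x : ℝ => x ^ α) (𝓝[>] 0) (𝓝 0) := by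
    have := (Real.continuousAt_rpow_const (0 : ℝ) α (Or.inr hα.le)).tendsto
    rw [Real.zero_rpow hα.ne'] at this
    exact this.mono_left nhdsWithin_le_nhds
  exact h1.comp tendsto_fst

lemma tendsto_fst_axis : Tendsto (fun q : ℝ × ℝ => q.1) (axisNhds s₀) (𝓝 0) :=
  tendsto_fst.mono_right nhdsWithin_le_nhds

lemma eventually_axis_pos : ∀ᶠ q in axisNhds s₀, 0 < q.1 :=
  tendsto_fst.eventually self_mem_nhdsWithin

/-- The `s`-derivative of a flux that vanishes on the axis vanishes there as well. -/
lemma IsFluxOn.tendsto_d2 (hI : IsOpen I) (hw : IsFluxOn w I)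
    (hlim : ∀ s ∈ I, Tendsto w (axisNhds s) (𝓝 0)) (hs : s₀ ∈ I) :
    Tendsto (d2 w) (axisNhds s₀) (𝓝 0) := by
  obtain ⟨C, hC⟩ := hw.isBigO_rpow hI hlim hs
  obtain ⟨C', hC'⟩ := hw.d2_isBigO hI hs (by norm_num) (by norm_num) hC
  refine squeeze_zero_norm' hC' ?_
  simpa using (tendsto_rpow_axis (s₀ := s₀) (α := 3 / 4 - 1 / 2) (by norm_num)).const_mul C'

/-! ### Limits at the axis from bounds on the derivative -/

lemma abs_sub_le_of_deriv_le {f f' g g' : ℝ → ℝ} {a b : ℝ} (hab : a ≤ b)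
    (hf : ∀ x ∈ Icc a b, HasDerivAt f (f' x) x) (hg : ∀ x ∈ Icc a b, HasDerivAt g (g' x) x)
    (h : ∀ x ∈ Icc a b, |f' x| ≤ g' x) : |f b - f a| ≤ g b - g a := by
  have mono {k k' : ℝ → ℝ} (hk : ∀ x ∈ Icc a b, HasDerivAt k (k' x) x)
      (hk' : ∀ x ∈ Icc a b, 0 ≤ k' x) : k a ≤ k b := by
    refine monotoneOn_of_deriv_nonneg (convex_Icc a b)
      (fun x hx => (hk x hx).continuousAt.continuousWithinAt)
      (fun x hx => (hk x (interior_subset hx)).differentiableAt.differentiableWithinAt)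
      (fun x hx => ?_) ⟨le_rfl, hab⟩ ⟨hab, le_rfl⟩ hab
    rw [(hk x (interior_subset hx)).deriv]
    exact hk' x (interior_subset hx)
  have h1 := mono (fun x hx => (hg x hx).sub (hf x hx))
    fun x hx => by linarith [(abs_le.1 (h x hx)).2]
  have h2 := mono (fun x hx => (hg x hx).add (hf x hx))
    fun x hx => by linarith [(abs_le.1 (h x hx)).1]
  simp only [Pi.add_apply, Pi.sub_apply] at h1 h2
  rw [abs_le]
  constructor <;> linarith

/-- A function whose `t`-derivative is `O(t ^ (-1/2))` has a limit at the axis. -/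
lemma exists_tendsto_of_d1_le (hI : IsOpen I) (hF : ContDiffOn ℝ ∞ F (strip I)) (hs : s₀ ∈ I)
    {C : ℝ} (hb : ∀ᶠ q in axisNhds s₀, |d1 F q| ≤ C * q.1 ^ (-1 / 2 : ℝ)) :
    ∃ l, Tendsto F (axisNhds s₀) (𝓝 l) := by
  have hCm : Cauchy (map F (axisNhds s₀)) := by
    rw [Metric.cauchy_iff]
    refine ⟨inferInstance, fun ε hε => ?_⟩
    obtain ⟨δ, hδ, h⟩ := eventually_axisNhds (hb.and (axisNhds_mem_strip hI hs))
    have hosc : ∀ t τ s, 0 < t → t ≤ τ → τ < δ → |s - s₀| < δ →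
        |F (τ, s) - F (t, s)| ≤ 2 * |C| * √τ := by
      intro t τ s h0 h1 h2 h3
      have := abs_sub_le_of_deriv_le (f := fun x => F (x, s)) (f' := fun x => d1 F (x, s))
        (g := fun x => |C| * (2 * x ^ (1 / 2 : ℝ))) (g' := fun x => |C| * x ^ (-1 / 2 : ℝ)) h1
        (fun x hx => hasDerivAt_d1 (differentiableAt_of_contDiffOn (isOpen_strip hI) hF
          (h x s (by linarith [hx.1]) (by linarith [hx.2]) h3).2))
        (fun x hx => ?_) (fun x hx => ?_)
      · refine this.trans ?_
        rw [Real.sqrt_eq_rpow]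
        have : 0 ≤ |C| * (2 * t ^ (1 / 2 : ℝ)) := by positivity
        linarith
      · refine HasDerivAt.const_mul |C| ?_
        refine ((hasDerivAt_rpow_of_pos (x := x) (p' := -1 / 2) (by linarith [hx.1])
          (by norm_num)).const_mul 2).congr_deriv ?_
        ring
      · have hx0 : 0 < x := by linarith [hx.1]
        refine (h x s hx0 (by linarith [hx.2]) h3).1.trans ?_
        dsimp
        gcongr
        exact le_abs_self C
    obtain ⟨τ, hτ0, hτδ, hτ⟩ : ∃ τ, 0 < τ ∧ τ < δ ∧ 2 * |C| * √τ < ε / 4 := by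
      have h1 : Tendsto (fun τ => 2 * |C| * √τ) (𝓝[>] 0) (𝓝 (2 * |C| * √0)) :=
        ((Real.continuous_sqrt.const_mul _).tendsto 0).mono_left nhdsWithin_le_nhds
      have h2 := h1.eventually (gt_mem_nhds (show 2 * |C| * √0 < ε / 4 by simp; positivity))
      have h3 : ∀ᶠ τ in 𝓝[>] (0 : ℝ), τ ∈ Ioo 0 δ := Ioo_mem_nhdsGT hδ
      obtain ⟨τ, ⟨h3, h4⟩, h5⟩ := (h3.and h2).exists
      exact ⟨τ, h3, h4, h5⟩
    have hc : ContinuousAt (fun s => F (τ, s)) s₀ :=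
      (hasDerivAt_d2 (differentiableAt_of_contDiffOn (isOpen_strip hI) hF ⟨hτ0, hs⟩)).continuousAt
    obtain ⟨η, hη, hcη⟩ := Metric.continuousAt_iff.1 hc (ε / 4) (by positivity)
    refine ⟨_, image_mem_map (axisNhds_of_forall (P := fun q => 0 < q.1 ∧ q.1 ≤ τ ∧
      |q.2 - s₀| < min δ η) (δ := min τ (min δ η)) (by positivity) ?_), ?_⟩
    · exact fun t s h0 h1 h2 => ⟨h0, h1.le.trans (min_le_left _ _), h2.trans_le (min_le_right _ _)⟩
    · rintro _ ⟨⟨t, s⟩, ⟨h0, h1, h2⟩, rfl⟩ _ ⟨⟨t', s'⟩, ⟨h0', h1', h2'⟩, rfl⟩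
      dsimp at h0 h1 h2 h0' h1' h2'
      have a1 := hosc t τ s h0 h1 hτδ (h2.trans_le (min_le_left _ _))
      have a2 := hosc t' τ s' h0' h1' hτδ (h2'.trans_le (min_le_left _ _))
      have a3 := hcη (x := s) (by rw [Real.dist_eq]; exact h2.trans_le (min_le_right _ _))
      have a4 := hcη (x := s') (by rw [Real.dist_eq]; exact h2'.trans_le (min_le_right _ _))
      rw [Real.dist_eq] at *
      rw [abs_le] at a1 a2
      rw [abs_lt] at a3 a4 ⊢
      constructor <;> linarith
  exact cauchy_map_iff_exists_tendsto.1 hCm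

/-- A function whose `t`-derivative is `O(t ^ (-3/2))` is `O(t ^ (-1/2))`. -/
lemma isBigO_of_d1_le (hI : IsOpen I) (hF : ContDiffOn ℝ ∞ F (strip I)) (hs : s₀ ∈ I)
    {C : ℝ} (hb : ∀ᶠ q in axisNhds s₀, |d1 F q| ≤ C * q.1 ^ (-3 / 2 : ℝ)) :
    ∃ C', ∀ᶠ q in axisNhds s₀, |F q| ≤ C' * q.1 ^ (-1 / 2 : ℝ) := by
  obtain ⟨δ, hδ, h⟩ := eventually_axisNhds (hb.and (axisNhds_mem_strip hI hs))
  set τ := min (δ / 2) 1 with hτ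
  have hτ0 : 0 < τ := by positivity
  have hτδ : τ < δ := (min_le_left _ _).trans_lt (by linarith)
  have hc : ContinuousAt (fun s => F (τ, s)) s₀ :=
    (hasDerivAt_d2 (differentiableAt_of_contDiffOn (isOpen_strip hI) hF ⟨hτ0, hs⟩)).continuousAt
  obtain ⟨η, hη, hcη⟩ := Metric.continuousAt_iff.1 hc 1 one_pos
  refine ⟨2 * |C| + (|F (τ, s₀)| + 1), axisNhds_of_forall (δ := min τ (min δ η)) (by positivity) ?_⟩
  intro t s h0 h1 h2
  have h1' : t < τ := h1.trans_le (min_le_left _ _)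
  have hsδ : |s - s₀| < δ := h2.trans_le ((min_le_right _ _).trans (min_le_left _ _))
  have hsη : |s - s₀| < η := h2.trans_le ((min_le_right _ _).trans (min_le_right _ _))
  have key := abs_sub_le_of_deriv_le (f := fun x => F (x, s)) (f' := fun x => d1 F (x, s))
    (g := fun x => |C| * (-2 * x ^ (-1 / 2 : ℝ))) (g' := fun x => |C| * x ^ (-3 / 2 : ℝ)) h1'.le
    (fun x hx => hasDerivAt_d1 (differentiableAt_of_contDiffOn (isOpen_strip hI) hF
      (h x s (by linarith [hx.1]) (by linarith [hx.2]) hsδ).2))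
    (fun x hx => ?_) (fun x hx => ?_)
  · have a3 := hcη (x := s) (by rw [Real.dist_eq]; exact hsη)
    rw [Real.dist_eq] at a3
    have hone : 1 ≤ t ^ (-1 / 2 : ℝ) := Real.one_le_rpow_of_pos_of_le_one_of_nonpos h0
      (h1'.le.trans (min_le_right _ _)) (by norm_num)
    have hB : |F (τ, s₀)| + 1 ≤ (|F (τ, s₀)| + 1) * t ^ (-1 / 2 : ℝ) :=
      le_mul_of_one_le_right (by positivity) hone
    have : 0 ≤ |C| * τ ^ (-1 / 2 : ℝ) := by positivity
    have b1 := abs_sub_abs_le_abs_sub (F (t, s)) (F (τ, s))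
    have b2 := abs_sub_abs_le_abs_sub (F (τ, s)) (F (τ, s₀))
    rw [abs_sub_comm] at b1
    dsimp at *
    linarith
  · refine HasDerivAt.const_mul |C| ?_
    refine ((hasDerivAt_rpow_of_pos (x := x) (p' := -3 / 2) (by linarith [hx.1])
      (by norm_num)).const_mul (-2)).congr_deriv ?_
    ring
  · have hx0 : 0 < x := by linarith [hx.1]
    refine (h x s hx0 (by linarith [hx.2]) hsδ).1.trans ?_
    dsimp
    gcongr
    exact le_abs_self C

end ToricInstanton

namespace ToricInstanton

open Set Filter

variable {F G w v : ℝ × ℝ → ℝ} {U : Set (ℝ × ℝ)} {I : Set ℝ} {t s s₀ : ℝ} {q : ℝ × ℝ}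

/-! ### Axisymmetric harmonic functions in the coordinates `(ρ², ζ)` -/

lemma d1_fst_mul (hG : DifferentiableAt ℝ G q) :
    d1 (fun p => p.1 * G p) q = G q + q.1 * d1 G q := by
  have h := differentiableAt_fst (𝕜 := ℝ) (p := q)
  simp [d1, fderiv_fun_mul h hG, fderiv_fst, add_comm]

lemma d2_fst_mul (hG : DifferentiableAt ℝ G q) :
    d2 (fun p => p.1 * G p) q = q.1 * d2 G q := by
  have h := differentiableAt_fst (𝕜 := ℝ) (p := q)
  simp [d2, fderiv_fun_mul h hG, fderiv_fst]

lemma d1_add (hF : DifferentiableAt ℝ F q) (hG : DifferentiableAt ℝ G q) :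
    d1 (fun p => F p + G p) q = d1 F q + d1 G q := by simp [d1, fderiv_fun_add hF hG]

lemma d2_add (hF : DifferentiableAt ℝ F q) (hG : DifferentiableAt ℝ G q) :
    d2 (fun p => F p + G p) q = d2 F q + d2 G q := by simp [d2, fderiv_fun_add hF hG]

lemma d1_const_mul (c : ℝ) (hG : DifferentiableAt ℝ G q) :
    d1 (fun p => c * G p) q = c * d1 G q := by simp [d1, fderiv_const_mul hG]

lemma d2_const_mul (c : ℝ) (hG : DifferentiableAt ℝ G q) :
    d2 (fun p => c * G p) q = c * d2 G q := by simp [d2, fderiv_const_mul hG]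

/-- `v(t, s)` is smooth for `t > 0`, `s ∈ I`, and `V(ρ, ζ) = v(ρ², ζ)` is an axisymmetric harmonic
function. -/
structure IsHarmOn (v : ℝ × ℝ → ℝ) (I : Set ℝ) : Prop where
  smooth : ContDiffOn ℝ ∞ v (strip I)
  eq : ∀ q ∈ strip I, 4 * (q.1 * d1 (d1 v) q + d1 v q) + d2 (d2 v) q = 0

/-- The flux `t v_t = ½ ρ V_ρ` through the circles around the axis. -/
noncomputable def flux (v : ℝ × ℝ → ℝ) (q : ℝ × ℝ) : ℝ := q.1 * d1 v q

lemma d1_flux (hI : IsOpen I) (hv : IsHarmOn v I) (hq : q ∈ strip I) :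
    d1 (flux v) q = -(1 / 4) * d2 (d2 v) q := by
  have h := d1_fst_mul (differentiableAt_of_contDiffOn (isOpen_strip hI)
    (contDiffOn_d1 (isOpen_strip hI) hv.smooth) hq)
  have := hv.eq q hq
  rw [show d1 (flux v) q = _ from h]
  linarith

lemma d2_flux (hI : IsOpen I) (hv : IsHarmOn v I) (hq : q ∈ strip I) :
    d2 (flux v) q = q.1 * d1 (d2 v) q := by
  have h := d2_fst_mul (differentiableAt_of_contDiffOn (isOpen_strip hI)
    (contDiffOn_d1 (isOpen_strip hI) hv.smooth) hq)
  rw [show d2 (flux v) q = _ from h, d1_d2_comm (isOpen_strip hI) hv.smooth hq]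

lemma IsHarmOn.isFluxOn (hI : IsOpen I) (hv : IsHarmOn v I) : IsFluxOn (flux v) I where
  smooth := contDiff_fst.contDiffOn.mul (contDiffOn_d1 (isOpen_strip hI) hv.smooth)
  eq q hq := by
    have hU := isOpen_strip hI
    have s2 := contDiffOn_d2 hU hv.smooth
    have s22 := contDiffOn_d2 hU s2
    have e1 : d1 (d1 (flux v)) q = -(1 / 4) * d1 (d2 (d2 v)) q := by
      rw [d1_congr hU (fun p hp => d1_flux hI hv hp) hq,
        d1_const_mul _ (differentiableAt_of_contDiffOn hU s22 hq)]
    have e2 : d2 (d2 (flux v)) q = q.1 * d2 (d1 (d2 v)) q := by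
      rw [d2_congr hU (fun p hp => d2_flux hI hv hp) hq,
        d2_fst_mul (differentiableAt_of_contDiffOn hU (contDiffOn_d1 hU s2) hq)]
    rw [e1, e2, d1_d2_comm hU s2 hq]
    ring

lemma IsHarmOn.partial_d2 (hI : IsOpen I) (hv : IsHarmOn v I) : IsHarmOn (d2 v) I where
  smooth := contDiffOn_d2 (isOpen_strip hI) hv.smooth
  eq q hq := by
    have hU := isOpen_strip hI
    have s1 := contDiffOn_d1 hU hv.smooth
    have s11 := contDiffOn_d1 hU s1
    have s22 := contDiffOn_d2 hU (contDiffOn_d2 hU hv.smooth)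
    have D {F : ℝ × ℝ → ℝ} (h : ContDiffOn ℝ ∞ F (strip I)) : DifferentiableAt ℝ F q :=
      differentiableAt_of_contDiffOn hU h hq
    have h0 := d2_congr (G := fun _ => 0) hU (fun p hp => hv.eq p hp) hq
    have hz : d2 (fun _ : ℝ × ℝ => (0 : ℝ)) q = 0 := by simp [d2]
    have s0 : ContDiffOn ℝ ∞ (fun p : ℝ × ℝ => p.1 * d1 (d1 v) p) (strip I) :=
      contDiff_fst.contDiffOn.mul s11
    rw [hz, d2_add (D ((contDiffOn_const (c := (4 : ℝ))).mul (s0.add s1))) (D s22),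
      d2_const_mul _ (D (s0.add s1)), d2_add (D s0) (D s1), d2_fst_mul (D s11),
      ← d1_d2_comm hU s1 hq, ← d1_d2_comm hU hv.smooth hq,
      d1_congr hU (fun p hp => (d1_d2_comm hU hv.smooth hp).symm) hq] at h0
    exact h0

/-- The flux of the harmonic function `v` vanishes on the part `I` of the axis, that is, `v` has no
logarithmic singularity there. -/
structure IsRegularOn (v : ℝ × ℝ → ℝ) (I : Set ℝ) : Prop extends IsHarmOn v I where
  flux_tendsto : ∀ s ∈ I, Tendsto (flux v) (axisNhds s) (𝓝 0)

lemma IsRegularOn.partial_d2 (hI : IsOpen I) (hv : IsRegularOn v I) : IsRegularOn (d2 v) I where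
  toIsHarmOn := hv.toIsHarmOn.partial_d2 hI
  flux_tendsto s hs := by
    refine ((hv.isFluxOn hI).tendsto_d2 hI hv.flux_tendsto hs).congr' ?_
    filter_upwards [axisNhds_mem_strip hI hs] with q hq using d2_flux hI hv.toIsHarmOn hq

/-- A harmonic function without flux extends continuously to the axis, as `v_t = O(t ^ (-1/4))`. -/
lemma IsRegularOn.exists_tendsto (hI : IsOpen I) (hv : IsRegularOn v I) (hs : s ∈ I) :
    ∃ l, Tendsto v (axisNhds s) (𝓝 l) := by
  obtain ⟨C, hC⟩ := (hv.isFluxOn hI).isBigO_rpow hI hv.flux_tendsto hs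
  have hlt : ∀ᶠ q in axisNhds s, q.1 < 1 := tendsto_fst_axis.eventually (gt_mem_nhds one_pos)
  refine exists_tendsto_of_d1_le hI hv.smooth hs (C := |C|) ?_
  filter_upwards [hC, hlt, eventually_axis_pos] with q h1 h2 h3
  have e : q.1 ^ (3 / 4 : ℝ) = q.1 * q.1 ^ (-1 / 4 : ℝ) := by
    nth_rewrite 2 [← Real.rpow_one q.1]
    rw [← Real.rpow_add h3]; norm_num
  rw [flux, abs_mul, abs_of_pos h3, e] at h1
  have h4 : |d1 v q| ≤ C * q.1 ^ (-1 / 4 : ℝ) := by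
    refine le_of_mul_le_mul_left ?_ h3
    linarith
  calc |d1 v q| ≤ C * q.1 ^ (-1 / 4 : ℝ) := h4
    _ ≤ |C| * q.1 ^ (-1 / 4 : ℝ) := by gcongr; exact le_abs_self C
    _ ≤ _ := by
      gcongr 1
      exact Real.rpow_le_rpow_of_exponent_ge h3 h2.le (by norm_num)

/-! ### Smoothness up to the axis -/

/-- If `∂_t (t ^ (j + 1) Q) = t ^ j R` without integration constant, then `Q` is a weighted
average of `R` over `(0, t)`, and has a limit at the axis if `R` has one. -/
lemma tendsto_of_average (hI : IsOpen I) {Q R : ℝ × ℝ → ℝ} {r : ℝ} (j : ℕ) (hs : s₀ ∈ I)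
    (hd : ∀ t s, (t, s) ∈ strip I →
      HasDerivAt (fun x => x ^ (j + 1) * Q (x, s)) (t ^ j * R (t, s)) t)
    (h0 : ∀ s ∈ I, Tendsto (fun q : ℝ × ℝ => q.1 ^ (j + 1) * Q q) (axisNhds s) (𝓝 0))
    (hR : Tendsto R (axisNhds s₀) (𝓝 r)) : Tendsto Q (axisNhds s₀) (𝓝 (r / (j + 1))) := by
  rw [Metric.tendsto_nhds] at hR ⊢
  intro ε hε
  obtain ⟨δ, hδ, h⟩ := eventually_axisNhds ((hR (ε / 2) (by positivity)).and
    (axisNhds_mem_strip hI hs))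
  refine axisNhds_of_forall hδ fun t s ht htδ hsδ => ?_
  have hsI : s ∈ I := (h t s ht htδ hsδ).2.2
  have hder (x : ℝ) : HasDerivAt (fun x : ℝ => x ^ (j + 1) / (j + 1)) (x ^ j) x := by
    refine ((hasDerivAt_pow (j + 1) x).div_const ((j : ℝ) + 1)).congr_deriv ?_
    push_cast
    field_simp
  have hle : ∀ a, 0 < a → a ≤ t →
      |(t ^ (j + 1) * Q (t, s) - r * (t ^ (j + 1) / (j + 1)))
        - (a ^ (j + 1) * Q (a, s) - r * (a ^ (j + 1) / (j + 1)))|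
      ≤ ε / 2 * (t ^ (j + 1) / (j + 1)) - ε / 2 * (a ^ (j + 1) / (j + 1)) := by
    intro a ha hat
    refine abs_sub_le_of_deriv_le (f := fun x => x ^ (j + 1) * Q (x, s)
      - r * (x ^ (j + 1) / (j + 1))) (f' := fun x => x ^ j * R (x, s) - r * x ^ j)
      (g := fun x => ε / 2 * (x ^ (j + 1) / (j + 1))) (g' := fun x => ε / 2 * x ^ j) hat
      (fun x hx => ?_) (fun x hx => (hder x).const_mul _) (fun x hx => ?_)
    · exact (hd x s ⟨show 0 < x by linarith [hx.1], hsI⟩).sub ((hder x).const_mul r)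
    · have hx0 : 0 < x := by linarith [hx.1]
      have h1 := (h x s hx0 (by linarith [hx.2]) hsδ).1
      rw [Real.dist_eq] at h1
      have e : x ^ j * R (x, s) - r * x ^ j = (R (x, s) - r) * x ^ j := by ring
      rw [e, abs_mul, abs_of_pos (pow_pos hx0 j)]
      gcongr
  have hline : Tendsto (fun a : ℝ => (a, s)) (𝓝[>] 0) (axisNhds s) :=
    tendsto_id.prodMk tendsto_const_nhds
  have hp : Tendsto (fun a : ℝ => a ^ (j + 1) / ((j : ℝ) + 1)) (𝓝[>] 0) (𝓝 0) := by
    have : Continuous fun a : ℝ => a ^ (j + 1) / ((j : ℝ) + 1) := by fun_prop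
    simpa using (this.tendsto 0).mono_left nhdsWithin_le_nhds
  have hlimit : |t ^ (j + 1) * Q (t, s) - r * (t ^ (j + 1) / (j + 1))|
      ≤ ε / 2 * (t ^ (j + 1) / (j + 1)) := by
    have k1 := (tendsto_const_nhds (x := t ^ (j + 1) * Q (t, s) - r * (t ^ (j + 1) / (j + 1)))).sub
      (((h0 s hsI).comp hline).sub (hp.const_mul r))
    have k2 := (tendsto_const_nhds (x := ε / 2 * (t ^ (j + 1) / ((j : ℝ) + 1)))).sub
      (hp.const_mul (ε / 2))
    simp only [mul_zero, sub_zero] at k1 k2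
    refine le_of_tendsto_of_tendsto k1.abs k2 ?_
    filter_upwards [Ioo_mem_nhdsGT ht] with a ha using hle a ha.1 ha.2.le
  have hpos : 0 < t ^ (j + 1) := pow_pos ht _
  have e : t ^ (j + 1) * Q (t, s) - r * (t ^ (j + 1) / (j + 1))
      = t ^ (j + 1) * (Q (t, s) - r / (j + 1)) := by ring
  rw [e, abs_mul, abs_of_pos hpos] at hlimit
  have h1 : |Q (t, s) - r / (j + 1)| ≤ ε / 2 / (j + 1) := by
    refine le_of_mul_le_mul_left ?_ hpos
    calc _ ≤ _ := hlimit
      _ = _ := by ring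
  rw [Real.dist_eq]
  refine h1.trans_lt ?_
  have h2 : ε / 2 / ((j : ℝ) + 1) ≤ ε / 2 := div_le_self (by positivity) (by simp)
  linarith

lemma contDiffOn_iterate_d1 (hU : IsOpen U) (h : ContDiffOn ℝ ∞ F U) (j : ℕ) :
    ContDiffOn ℝ ∞ (d1^[j] F) U := by
  induction j with
  | zero => exact h
  | succ j ih => rw [Function.iterate_succ_apply']; exact contDiffOn_d1 hU ih

lemma d2_iterate_d1 (hU : IsOpen U) (h : ContDiffOn ℝ ∞ F U) (j : ℕ) :
    EqOn (d2 (d1^[j] F)) (d1^[j] (d2 F)) U := by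
  induction j with
  | zero => exact fun q _ => rfl
  | succ j ih =>
    intro q hq
    rw [Function.iterate_succ_apply', Function.iterate_succ_apply',
      ← d1_d2_comm hU (contDiffOn_iterate_d1 hU h j) hq]
    exact d1_congr hU ih hq

/-- The equation `4 (t v_t)_t + v_ss = 0`, differentiated `j` times in `t`. -/
lemma IsHarmOn.iterate_d1_eq (hI : IsOpen I) (hv : IsHarmOn v I) (j : ℕ) :
    EqOn (fun q => q.1 * d1^[j + 2] v q + (j + 1) * d1^[j + 1] v q)
      (fun q => -(1 / 4) * d1^[j] (d2 (d2 v)) q) (strip I) := by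
  have hU := isOpen_strip hI
  induction j with
  | zero =>
    intro q hq
    have := hv.eq q hq
    simp only [Function.iterate_succ_apply', Function.iterate_zero, id]
    push_cast
    linarith
  | succ j ih =>
    intro q hq
    have D (k : ℕ) : DifferentiableAt ℝ (d1^[k] v) q :=
      differentiableAt_of_contDiffOn hU (contDiffOn_iterate_d1 hU hv.smooth k) hq
    have D2 : DifferentiableAt ℝ (d1^[j] (d2 (d2 v))) q :=
      differentiableAt_of_contDiffOn hU (contDiffOn_iterate_d1 hU
        (contDiffOn_d2 hU (contDiffOn_d2 hU hv.smooth)) j) hq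
    have h := d1_congr hU ih hq
    rw [d1_add (differentiableAt_fst.fun_mul (D _)) ((D _).const_mul _), d1_fst_mul (D _),
      d1_const_mul _ (D _), d1_const_mul _ D2] at h
    rw [← Function.iterate_succ_apply' d1, ← Function.iterate_succ_apply' d1,
      ← Function.iterate_succ_apply' d1] at h
    push_cast
    linear_combination h

/-- All `t`-derivatives of a harmonic function without flux have limits at the axis. -/
lemma IsRegularOn.exists_tendsto_iterate (hI : IsOpen I) (j : ℕ) : ∀ {v : ℝ × ℝ → ℝ},
    IsRegularOn v I → ∀ s ∈ I, ∃ l, Tendsto (d1^[j] v) (axisNhds s) (𝓝 l) := by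
  have hU := isOpen_strip hI
  induction j using Nat.strong_induction_on with
  | _ j ih =>
    intro v hv s hs
    rcases j with _ | j
    · exact hv.exists_tendsto hI hs
    obtain ⟨r, hr⟩ := ih j (by omega) ((hv.partial_d2 hI).partial_d2 hI) s hs
    refine ⟨_, tendsto_of_average hI (R := fun q => -(1 / 4) * d1^[j] (d2
      (d2 v)) q) j hs (fun t s' hq => ?_) (fun s' hs' => ?_) (hr.const_mul _)⟩
    · have h1 := hasDerivAt_d1 (differentiableAt_of_contDiffOn hU
        (contDiffOn_iterate_d1 hU hv.smooth (j + 1)) hq)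
      rw [← Function.iterate_succ_apply' d1] at h1
      refine ((hasDerivAt_pow (j + 1) t).mul h1).congr_deriv ?_
      have := hv.iterate_d1_eq hI j hq
      simp only at this
      rw [← this]
      push_cast
      ring
    · rcases j with _ | j
      · refine (hv.flux_tendsto s' hs').congr fun q => ?_
        simp [flux]
      · obtain ⟨l1, hl1⟩ := ih (j + 1) (by omega) hv s' hs'
        obtain ⟨l2, hl2⟩ := ih j (by omega) ((hv.partial_d2 hI).partial_d2 hI) s' hs'
        have h1 := (hl2.const_mul (-(1 / 4))).sub (hl1.const_mul ((j : ℝ) + 1))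
        have h2 := ((tendsto_fst_axis (s₀ := s')).pow (j + 1)).mul h1
        rw [zero_pow (by omega), zero_mul] at h2
        refine h2.congr' ?_
        filter_upwards [axisNhds_mem_strip hI hs'] with q hq
        have := hv.iterate_d1_eq hI j hq
        simp only at this
        rw [← this]
        ring

/-- A family of functions on the strip that is closed under both partial derivatives, all of whose
members have limits at the axis, consists of functions that are smooth up to the axis. -/
lemma contDiffOn_extendFrom_strip (hI : IsOpen I) {F : ℕ → ℕ → ℝ × ℝ → ℝ}
    (hF : ∀ j k, ∀ q ∈ strip I, HasFDerivAt (F j k)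
      (F (j + 1) k q • ContinuousLinearMap.fst ℝ ℝ ℝ
        + F j (k + 1) q • ContinuousLinearMap.snd ℝ ℝ ℝ) q)
    (hlim : ∀ j k, ∀ s ∈ I, ∃ l, Tendsto (F j k) (axisNhds s) (𝓝 l)) (n : ℕ) : ∀ j k,
    ContDiffOn ℝ n (extendFrom (strip I) (F j k)) (Ici (0 : ℝ) ×ˢ I) := by
  have hU := isOpen_strip hI
  have hcl : Ici (0 : ℝ) ×ˢ I ⊆ closure (strip I) := by
    rw [closure_prod_eq, closure_Ioi]
    exact prod_mono le_rfl subset_closure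
  have hcont : ∀ j k, ContinuousOn (F j k) (strip I) := fun j k q hq =>
    (hF j k q hq).continuousAt.continuousWithinAt
  have hlim' : ∀ j k, ∀ q ∈ Ici (0 : ℝ) ×ˢ I, ∃ l, Tendsto (F j k) (𝓝[strip I] q) (𝓝 l) := by
    rintro j k ⟨t, s⟩ ⟨ht, hs⟩
    rcases (show 0 ≤ t from ht).eq_or_lt with rfl | ht
    · rw [nhdsWithin_strip hI hs]
      exact hlim j k s hs
    · exact ⟨_, hcont j k _ ⟨ht, hs⟩⟩
  have hext : ∀ j k, EqOn (extendFrom (strip I) (F j k)) (F j k) (strip I) := fun j k =>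
    extendFrom_extends (hcont j k)
  have hcext : ∀ j k, ContinuousOn (extendFrom (strip I) (F j k)) (Ici (0 : ℝ) ×ˢ I) :=
    fun j k => continuousOn_extendFrom hcl (hlim' j k)
  have hint : ∀ j k, ∀ q ∈ strip I, HasFDerivAt (extendFrom (strip I) (F j k))
      (F (j + 1) k q • ContinuousLinearMap.fst ℝ ℝ ℝ
        + F j (k + 1) q • ContinuousLinearMap.snd ℝ ℝ ℝ) q := fun j k q hq =>
    (hF j k q hq).congr_of_eventuallyEq ((hext j k).eventuallyEq_of_mem (hU.mem_nhds hq))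
  have hder : ∀ j k, ∀ q ∈ Ici (0 : ℝ) ×ˢ I, HasFDerivWithinAt (extendFrom (strip I) (F j k))
      (extendFrom (strip I) (F (j + 1) k) q • ContinuousLinearMap.fst ℝ ℝ ℝ
        + extendFrom (strip I) (F j (k + 1)) q • ContinuousLinearMap.snd ℝ ℝ ℝ)
      (Ici (0 : ℝ) ×ˢ I) q := by
    rintro j k ⟨t, s⟩ ⟨ht, hs⟩
    rcases (show 0 ≤ t from ht).eq_or_lt with rfl | ht
    · obtain ⟨ε, hε, hball⟩ := Metric.nhds_basis_closedBall.mem_iff.1 (hI.mem_nhds hs)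
      rw [Real.closedBall_eq_Icc] at hball
      set S : Set (ℝ × ℝ) := Ioo (0 : ℝ) 1 ×ˢ Ioo (s - ε) (s + ε) with hS
      have hclS : closure S = Icc (0 : ℝ) 1 ×ˢ Icc (s - ε) (s + ε) := by
        rw [hS, closure_prod_eq, closure_Ioo (by norm_num), closure_Ioo (by linarith)]
      have hSsub : S ⊆ strip I := prod_mono Ioo_subset_Ioi_self (Ioo_subset_Icc_self.trans hball)
      have hSsub' : S ⊆ Ici (0 : ℝ) ×ˢ I := hSsub.trans (prod_mono Ioi_subset_Ici_self le_rfl)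
      have hclsub : closure S ⊆ Ici (0 : ℝ) ×ˢ I := by
        rw [hclS]
        exact prod_mono (fun x hx => hx.1) hball
      have hl := fun j k => (tendsto_extendFrom (hlim' j k (0, s) ⟨mem_Ici.2 le_rfl, hs⟩)).mono_left
        (nhdsWithin_mono _ hSsub)
      have key := hasFDerivWithinAt_closure_of_tendsto_fderiv (s := S) (x := (0, s))
        (f := extendFrom (strip I) (F j k))
        (fun q hq => (hint j k q (hSsub hq)).differentiableAt.differentiableWithinAt)
        ((convex_Ioo 0 1).prod (convex_Ioo _ _)) (isOpen_Ioo.prod isOpen_Ioo)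
        (fun y hy => (hcext j k y (hclsub hy)).mono hSsub')
        (((((hl (j + 1) k).smul_const (ContinuousLinearMap.fst ℝ ℝ ℝ)).add
          ((hl j (k + 1)).smul_const (ContinuousLinearMap.snd ℝ ℝ ℝ)))).congr' ?_)
      · refine key.mono_of_mem_nhdsWithin ?_
        rw [hclS, nhdsWithin_prod_eq]
        exact prod_mem_prod (Icc_mem_nhdsGE one_pos)
          (mem_nhdsWithin_of_mem_nhds (Icc_mem_nhds (by linarith) (by linarith)))
      · filter_upwards [self_mem_nhdsWithin] with q hq
        exact (hint j k q (hSsub hq)).fderiv.symm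
    · have hq : (t, s) ∈ strip I := ⟨ht, hs⟩
      rw [hext (j + 1) k hq, hext j (k + 1) hq]
      exact (hint j k _ hq).hasFDerivWithinAt
  induction n with
  | zero => exact fun j k => contDiffOn_zero.2 (hcext j k)
  | succ n ih =>
    intro j k
    push_cast
    rw [contDiffOn_succ_iff_hasFDerivWithinAt_of_uniqueDiffOn
      ((uniqueDiffOn_Ici 0).prod hI.uniqueDiffOn)]
    exact ⟨by simp, _, ((ih (j + 1) k).smul contDiffOn_const).add
      ((ih j (k + 1)).smul contDiffOn_const), hder j k⟩

lemma IsRegularOn.iterate_d2 (hI : IsOpen I) (hv : IsRegularOn v I) (k : ℕ) :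
    IsRegularOn (d2^[k] v) I := by
  induction k with
  | zero => exact hv
  | succ k ih => rw [Function.iterate_succ_apply']; exact ih.partial_d2 hI

/-- Removable singularities: a harmonic function without flux through the axis is a smooth function
of `(ρ², ζ)` up to the axis. -/
theorem IsRegularOn.contDiffOn_extendFrom (hI : IsOpen I) (hv : IsRegularOn v I) :
    ContDiffOn ℝ ∞ (extendFrom (strip I) v) (Ici (0 : ℝ) ×ˢ I) := by
  have hU := isOpen_strip hI
  refine contDiffOn_infty.2 fun n => ?_
  refine contDiffOn_extendFrom_strip hI (F := fun j k => d1^[j] (d2^[k] v))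
    (fun j k q hq => ?_) (fun j k s hs => (hv.iterate_d2 hI k).exists_tendsto_iterate hI j s hs)
    n 0 0
  have hs := (hv.iterate_d2 hI k).smooth
  have h := hasFDerivAt_d1_d2 (differentiableAt_of_contDiffOn hU (contDiffOn_iterate_d1 hU hs j) hq)
  rw [d2_iterate_d1 hU hs j hq] at h
  simpa only [Function.iterate_succ_apply'] using h

end ToricInstanton

namespace ToricInstanton

open Set Filter

variable {F G w v h W : ℝ × ℝ → ℝ} {U : Set (ℝ × ℝ)} {I : Set ℝ} {t s s₀ c : ℝ} {q : ℝ × ℝ}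

/-! ### Boundary values on the axis -/

lemma tendsto_line_axis : Tendsto (fun a : ℝ => (a, s)) (𝓝[>] 0) (axisNhds s) :=
  tendsto_id.prodMk tendsto_const_nhds

lemma continuousOn_of_tendsto_axis {Q : ℝ → ℝ} (hI : IsOpen I)
    (h : ∀ s ∈ I, Tendsto F (axisNhds s) (𝓝 (Q s))) : ContinuousOn Q I := by
  intro s₀ hs₀
  refine ContinuousAt.continuousWithinAt ?_
  rw [Metric.continuousAt_iff]
  intro ε hε
  obtain ⟨δ, hδ, hb⟩ := eventually_axisNhds ((Metric.tendsto_nhds.1 (h s₀ hs₀) (ε / 2)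
    (by positivity)).and (axisNhds_mem_strip hI hs₀))
  refine ⟨δ, hδ, fun {s} hs => ?_⟩
  rw [Real.dist_eq] at hs
  have hsI : s ∈ I := (hb (δ / 2) s (by positivity) (by linarith) hs).2.2
  have h1 : dist (Q s) (Q s₀) ≤ ε / 2 := by
    refine le_of_tendsto (((h s hsI).comp tendsto_line_axis).dist tendsto_const_nhds) ?_
    filter_upwards [Ioo_mem_nhdsGT hδ] with t ht using (hb t s ht.1 ht.2 hs).1.le
  linarith

lemma hasDerivAt_of_tendsto_axis {Q Q' : ℝ → ℝ} (hI : IsOpen I) (hF : ContDiffOn ℝ ∞ F (strip I))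
    (h : ∀ s ∈ I, Tendsto F (axisNhds s) (𝓝 (Q s)))
    (h' : ∀ s ∈ I, Tendsto (d2 F) (axisNhds s) (𝓝 (Q' s))) (hs : s ∈ I) :
    HasDerivAt Q (Q' s) s := by
  refine hasDerivAt_of_tendstoLocallyUniformlyOn (l := 𝓝[>] (0 : ℝ)) (f := fun t s => F (t, s))
    (f' := fun t s => d2 F (t, s)) hI ?_ ?_ (fun x hx => (h x hx).comp tendsto_line_axis) hs
  · rw [hI.tendstoLocallyUniformlyOn_iff_forall_tendsto]
    intro x hx
    have hc : ContinuousAt Q' x :=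
      (continuousOn_of_tendsto_axis hI h').continuousAt (hI.mem_nhds hx)
    exact ((hc.tendsto.comp tendsto_snd).prodMk_nhds (h' x hx)).mono_right (nhds_le_uniformity _)
  · filter_upwards [self_mem_nhdsWithin] with t ht x hx
    exact hasDerivAt_d2 (differentiableAt_of_contDiffOn (isOpen_strip hI) hF ⟨ht, hx⟩)

/-- If the flux of `v` has a limit at the axis, then `v_s = O(t ^ (-1/2))`. -/
lemma IsHarmOn.d2_isBigO (hI : IsOpen I) (hv : IsHarmOn v I) {l : ℝ} (hs : s₀ ∈ I)
    (hu : Tendsto (flux v) (axisNhds s₀) (𝓝 l)) :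
    ∃ C, ∀ᶠ q in axisNhds s₀, |d2 v q| ≤ C * q.1 ^ (-1 / 2 : ℝ) := by
  have hb : ∀ᶠ q in axisNhds s₀, |flux v q| ≤ (|l| + 1) * q.1 ^ (0 : ℝ) := by
    filter_upwards [hu.abs.eventually (gt_mem_nhds (lt_add_one |l|))] with q hq
    rw [Real.rpow_zero, mul_one]
    exact hq.le
  obtain ⟨C, hC⟩ := (hv.isFluxOn hI).d2_isBigO hI hs le_rfl zero_le_one hb
  refine isBigO_of_d1_le hI (contDiffOn_d2 (isOpen_strip hI) hv.smooth) hs (C := C) ?_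
  filter_upwards [hC, axisNhds_mem_strip hI hs] with q hq hqs
  have h0 : 0 < q.1 := hqs.1
  rw [d2_flux hI hv hqs, abs_mul, abs_of_pos h0] at hq
  refine le_of_mul_le_mul_left ?_ h0
  calc _ ≤ _ := hq
    _ = C * (q.1 ^ (1 : ℝ) * q.1 ^ (-3 / 2 : ℝ)) := by
      rw [← Real.rpow_add h0]; norm_num
    _ = _ := by rw [Real.rpow_one]; ring

/-- The harmonic conjugate has a limit at the axis if the flux does. -/
lemma IsHarmOn.exists_tendsto_conjugate (hI : IsOpen I) (hv : IsHarmOn v I) {l : ℝ} (hs : s₀ ∈ I)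
    (hu : Tendsto (flux v) (axisNhds s₀) (𝓝 l)) (hh : ContDiffOn ℝ ∞ h (strip I))
    (hh1 : ∀ q ∈ strip I, d1 h q = -(1 / 2) * d2 v q) :
    ∃ k, Tendsto h (axisNhds s₀) (𝓝 k)
      ∧ Tendsto (fun q => 1 / 2 * q.1 * d2 v q + h q) (axisNhds s₀) (𝓝 k) := by
  obtain ⟨C, hC⟩ := hv.d2_isBigO hI hs hu
  obtain ⟨k, hk⟩ := exists_tendsto_of_d1_le hI hh hs (C := C / 2) (by
    filter_upwards [hC, axisNhds_mem_strip hI hs] with q hq hqs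
    rw [hh1 q hqs, abs_mul]
    norm_num
    linarith)
  refine ⟨k, hk, ?_⟩
  have h0 : Tendsto (fun q => 1 / 2 * q.1 * d2 v q) (axisNhds s₀) (𝓝 0) := by
    refine squeeze_zero_norm' (a := fun q => 1 / 2 * C * q.1 ^ (1 / 2 : ℝ)) ?_ ?_
    · filter_upwards [hC, eventually_axis_pos] with q hq h0
      have e : q.1 ^ (1 / 2 : ℝ) = q.1 * q.1 ^ (-1 / 2 : ℝ) := by
        nth_rewrite 2 [← Real.rpow_one q.1]
        rw [← Real.rpow_add h0]; norm_num
      rw [Real.norm_eq_abs, abs_mul, abs_of_pos (by positivity : 0 < 1 / 2 * q.1), e]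
      calc _ ≤ 1 / 2 * q.1 * (C * q.1 ^ (-1 / 2 : ℝ)) := by gcongr
        _ = _ := by ring
    · simpa using (tendsto_rpow_axis (s₀ := s₀) (α := 1 / 2) (by norm_num)).const_mul (1 / 2 * C)
  simpa using h0.add hk

/-! ### The Tod form near a rod -/

/-- The squared length of the differential of `u`, in the coordinates `(t, s) = (ρ², ζ)` and for
the metric `dρ² + dζ²`. -/
noncomputable def gradSq (u : ℝ × ℝ → ℝ) (q : ℝ × ℝ) : ℝ := 4 * q.1 * d1 u q ^ 2 + d2 u q ^ 2

lemma gradSq_identity (u : ℝ × ℝ → ℝ) (q : ℝ × ℝ) :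
    q.1 * (2 * d1 u q / gradSq u q) ^ 2 + (d2 u q / gradSq u q) ^ 2 = (gradSq u q)⁻¹ := by
  rcases eq_or_ne (gradSq u q) 0 with h | h
  -- where the gradient vanishes, all terms are zero by the convention for division by zero
  · simp [h]
  · field_simp
    rw [gradSq]
    ring

/-- The functions `W` and `F` of the Tod form, on the strip over `I` and in the coordinates
`(t, s) = (ρ², ζ)`; `h` is the harmonic conjugate of the potential `v`, and `u = t v_t = Ω⁻¹`. -/
structure IsTodOn (c : ℝ) (v h W F : ℝ × ℝ → ℝ) (I : Set ℝ) : Prop where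
  c_ne_zero : c ≠ 0
  harm : IsHarmOn v I
  smooth_conj : ContDiffOn ℝ ∞ h (strip I)
  conj1 : ∀ q ∈ strip I, d1 h q = -(1 / 2) * d2 v q
  conj2 : ∀ q ∈ strip I, d2 h q = 2 * flux v q
  W_pos : ∀ q ∈ strip I, 0 < W q
  W_eq : ∀ q ∈ strip I, c * W q = flux v q
    - flux v q ^ 2 * (2 * d1 (flux v) q / gradSq (flux v) q)
  F_eq : ∀ q ∈ strip I, c * F q = flux v q ^ 2 * (d2 (flux v) q / gradSq (flux v) q)
    - (1 / 2 * q.1 * d2 v q + h q)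

/-- Where `∂_τ` does not vanish on the axis, the equation `u_s = u² / (k + c F)` holds there. Here
`k` is the boundary value of the harmonic conjugate. -/
lemma IsTodOn.tendsto_d2_flux (hI : IsOpen I) (hT : IsTodOn c v h W F I) (hs : s ∈ I)
    {f k α F₀ : ℝ} (hf : 0 < f) (hα : 0 < α) (hN : k + c * F₀ ≠ 0)
    (hu : Tendsto (flux v) (axisNhds s) (𝓝 f))
    (hk : Tendsto (fun q => 1 / 2 * q.1 * d2 v q + h q) (axisNhds s) (𝓝 k))
    (hW : Tendsto (fun q => (W q)⁻¹) (axisNhds s) (𝓝 α))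
    (hF : Tendsto (fun q => F q * (W q)⁻¹) (axisNhds s) (𝓝 (F₀ * α))) :
    Tendsto (d2 (flux v)) (axisNhds s) (𝓝 (f ^ 2 / (k + c * F₀))) := by
  have hst := axisNhds_mem_strip hI hs
  have hu0 : ∀ᶠ q in axisNhds s, 0 < flux v q := hu.eventually (lt_mem_nhds hf)
  have hW' : Tendsto W (axisNhds s) (𝓝 α⁻¹) := by
    simpa using hW.inv₀ hα.ne'
  have hF' : Tendsto F (axisNhds s) (𝓝 F₀) := by
    have h1 := hF.mul hW'
    rw [mul_assoc, mul_inv_cancel₀ hα.ne', mul_one] at h1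
    refine h1.congr' ?_
    filter_upwards [hst] with q hq
    rw [mul_assoc, inv_mul_cancel₀ (hT.W_pos q hq).ne', mul_one]
  have hA : Tendsto (fun q => d2 (flux v) q / gradSq (flux v) q) (axisNhds s)
      (𝓝 ((c * F₀ + k) / f ^ 2)) := by
    refine (((hF'.const_mul c).add hk).div (hu.pow 2) (by positivity)).congr' ?_
    filter_upwards [hst, hu0] with q hq hq0
    simp only [Pi.div_apply]
    rw [hT.F_eq q hq, sub_add_cancel, mul_div_cancel_left₀ _ (by positivity)]
  have hS : Tendsto (fun q => 2 * d1 (flux v) q / gradSq (flux v) q) (axisNhds s)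
      (𝓝 ((f - c * α⁻¹) / f ^ 2)) := by
    refine ((hu.sub (hW'.const_mul c)).div (hu.pow 2) (by positivity)).congr' ?_
    filter_upwards [hst, hu0] with q hq hq0
    simp only [Pi.div_apply]
    rw [hT.W_eq q hq, sub_sub_cancel, mul_div_cancel_left₀ _ (by positivity)]
  have hD : Tendsto (fun q => (gradSq (flux v) q)⁻¹) (axisNhds s)
      (𝓝 (((c * F₀ + k) / f ^ 2) ^ 2)) := by
    have h1 := ((tendsto_fst_axis (s₀ := s)).mul (hS.pow 2)).add (hA.pow 2)
    rw [zero_mul, zero_add] at h1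
    exact h1.congr fun q => gradSq_identity _ q
  have hN' : (c * F₀ + k) / f ^ 2 ≠ 0 := by
    rw [add_comm]
    positivity
  have h1 := hA.div hD (by positivity)
  have e : (c * F₀ + k) / f ^ 2 / ((c * F₀ + k) / f ^ 2) ^ 2 = f ^ 2 / (k + c * F₀) := by
    rw [add_comm] at hN' ⊢
    field_simp
  rw [e] at h1
  refine h1.congr' ?_
  filter_upwards [hD.eventually_ne (by positivity)] with q hq
  have hq' : gradSq (flux v) q ≠ 0 := fun h0 => hq (by simp [h0])
  simp only [Pi.div_apply]
  field_simp

/-- Where `∂_τ` vanishes on the axis, and `∂_y` does not, one has `u_s → 0`. -/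
lemma IsTodOn.tendsto_d2_flux_zero (hI : IsOpen I) (hT : IsTodOn c v h W F I) (hs : s ∈ I)
    {f k β : ℝ} (hf : 0 < f) (hβ : 0 < β)
    (hu : Tendsto (flux v) (axisNhds s) (𝓝 f))
    (hk : Tendsto (fun q => 1 / 2 * q.1 * d2 v q + h q) (axisNhds s) (𝓝 k))
    (hW : Tendsto (fun q => (W q)⁻¹) (axisNhds s) (𝓝 0))
    (hF : Tendsto (fun q => F q * (W q)⁻¹) (axisNhds s) (𝓝 0))
    (hG : Tendsto (fun q => F q ^ 2 * (W q)⁻¹ + W q * q.1) (axisNhds s) (𝓝 β)) :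
    Tendsto (d2 (flux v)) (axisNhds s) (𝓝 0) := by
  have hc := hT.c_ne_zero
  have hst := axisNhds_mem_strip hI hs
  have hu0 : ∀ᶠ q in axisNhds s, 0 < flux v q := hu.eventually (lt_mem_nhds hf)
  have hA : Tendsto (fun q => d2 (flux v) q / gradSq (flux v) q * (W q)⁻¹) (axisNhds s)
      (𝓝 0) := by
    have h1 := ((hF.const_mul c).add (hk.mul hW)).div (hu.pow 2) (by positivity)
    simp only [mul_zero, add_zero, zero_div] at h1
    refine h1.congr' ?_
    filter_upwards [hst, hu0] with q hq hq0
    simp only [Pi.div_apply]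
    rw [← mul_assoc, hT.F_eq q hq, ← add_mul, sub_add_cancel]
    field_simp
  -- `(W |du|²)⁻¹` has a positive limit: expand `|du|⁻² = t S² + A²` in terms of the Gram matrix
  have hD : Tendsto (fun q => (gradSq (flux v) q)⁻¹ * (W q)⁻¹) (axisNhds s)
      (𝓝 (c ^ 2 * β / f ^ 4)) := by
    have h1 := ((((hG.const_mul (c ^ 2)).add ((tendsto_fst_axis (s₀ := s)).mul
      ((hu.const_mul (-2 * c)).add ((hu.pow 2).mul hW)))).add
      ((hk.const_mul (2 * c)).mul hF)).add ((hk.pow 2).mul hW)).div (hu.pow 4) (by positivity)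
    simp only [mul_zero, add_zero, zero_mul] at h1
    refine h1.congr' ?_
    filter_upwards [hst, hu0] with q hq hq0
    have hWq := (hT.W_pos q hq).ne'
    have e1 : 2 * d1 (flux v) q / gradSq (flux v) q = (flux v q - c * W q) / flux v q ^ 2 := by
      rw [hT.W_eq q hq, sub_sub_cancel, mul_div_cancel_left₀ _ (by positivity)]
    have e2 : d2 (flux v) q / gradSq (flux v) q
        = (c * F q + (1 / 2 * q.1 * d2 v q + h q)) / flux v q ^ 2 := by
      rw [hT.F_eq q hq, sub_add_cancel, mul_div_cancel_left₀ _ (by positivity)]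
    simp only [Pi.div_apply]
    rw [← gradSq_identity, e1, e2]
    field_simp
    ring
  have hlim : c ^ 2 * β / f ^ 4 ≠ 0 := by positivity
  have h1 := hA.div hD hlim
  rw [zero_div] at h1
  refine h1.congr' ?_
  filter_upwards [hst, hD.eventually_ne hlim] with q hq hq'
  have hWq := (hT.W_pos q hq).ne'
  have hq'' : gradSq (flux v) q ≠ 0 := fun h0 => hq' (by simp [h0])
  simp only [Pi.div_apply]
  field_simp

/-- If `N' = 2 f` and `f' = f² / N` off the zeros of `N`, for a positive function `f`, then `N` has
no zeros and `f` is affine: off the zeros `f² / N` is constant, and a zero of `N` would be a zero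
of `f`. -/
lemma affine_of_ode {f N : ℝ → ℝ} (hI : IsOpen I) (hIc : I.OrdConnected)
    (hf : ∀ s ∈ I, 0 < f s) (hfc : ContinuousOn f I)
    (hN : ∀ s ∈ I, HasDerivAt N (2 * f s) s)
    (hf' : ∀ s ∈ I, N s ≠ 0 → HasDerivAt f (f s ^ 2 / N s) s) :
    ∃ m k : ℝ, ∀ s ∈ I, f s = m * s + k := by
  have hconst : ∀ J ⊆ I, IsOpen J → IsPreconnected J → (∀ s ∈ J, N s ≠ 0) →
      ∃ m, ∀ s ∈ J, f s ^ 2 / N s = m := by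
    intro J hJI hJ hJc hJN
    have hd : ∀ s ∈ J, HasDerivAt (fun s => f s ^ 2 / N s) 0 s := by
      intro s hs
      have h0 := hJN s hs
      refine (((hf' s (hJI hs) h0).pow 2).div (hN s (hJI hs)) h0).congr_deriv ?_
      simp only [Pi.pow_apply]
      field_simp
      ring
    exact hJ.exists_is_const_of_deriv_eq_zero hJc
      (fun s hs => (hd s hs).differentiableAt.differentiableWithinAt) fun s hs => (hd s hs).deriv
  have hN0 : ∀ s ∈ I, N s ≠ 0 := by
    intro s hs hz
    obtain ⟨ε, hε, hball⟩ := Metric.nhds_basis_closedBall.mem_iff.1 (hI.mem_nhds hs)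
    rw [Real.closedBall_eq_Icc] at hball
    obtain ⟨b, hsb, hsub⟩ : ∃ b, s < b ∧ Icc s b ⊆ I :=
      ⟨s + ε, by linarith, (Icc_subset_Icc_left (by linarith)).trans hball⟩
    have hmono : StrictMonoOn N (Icc s b) := by
      refine strictMonoOn_of_deriv_pos (convex_Icc s b)
        (fun x hx => (hN x (hsub hx)).continuousAt.continuousWithinAt) fun x hx => ?_
      rw [interior_Icc] at hx
      rw [(hN x (hsub (Ioo_subset_Icc_self hx))).deriv]
      have := hf x (hsub (Ioo_subset_Icc_self hx))
      positivity
    have hpos : ∀ x ∈ Ioo s b, 0 < N x := fun x hx => by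
      rw [← hz]
      exact hmono ⟨le_rfl, hsb.le⟩ (Ioo_subset_Icc_self hx) hx.1
    obtain ⟨m, hm⟩ := hconst (Ioo s b) (Ioo_subset_Icc_self.trans hsub) isOpen_Ioo
      isPreconnected_Ioo fun x hx => (hpos x hx).ne'
    have hl : Tendsto (fun x => f x ^ 2) (𝓝[>] s) (𝓝 (f s ^ 2)) :=
      ((hfc.continuousAt (hI.mem_nhds hs)).tendsto.mono_left nhdsWithin_le_nhds).pow 2
    have hr : Tendsto (fun x => m * N x) (𝓝[>] s) (𝓝 (m * N s)) :=
      ((hN s hs).continuousAt.tendsto.mono_left nhdsWithin_le_nhds).const_mul m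
    have heq : f s ^ 2 = m * N s := by
      refine tendsto_nhds_unique hl (hr.congr' ?_)
      filter_upwards [Ioo_mem_nhdsGT hsb] with x hx
      rw [← hm x hx, div_mul_cancel₀ _ (hpos x hx).ne']
    rw [hz, mul_zero] at heq
    exact (pow_pos (hf s hs) 2).ne' heq
  have hpre : IsPreconnected I := hIc.isPreconnected
  obtain ⟨m, hm⟩ := hconst I le_rfl hI hpre hN0
  have hd : ∀ s ∈ I, HasDerivAt (fun s => f s - m * s) 0 s := by
    intro s hs
    have h1 := hf' s hs (hN0 s hs)
    rw [hm s hs] at h1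
    exact (h1.sub ((hasDerivAt_id s).const_mul m)).congr_deriv (by ring)
  obtain ⟨k, hk⟩ := hI.exists_is_const_of_deriv_eq_zero hpre
    (fun s hs => (hd s hs).differentiableAt.differentiableWithinAt) fun s hs => (hd s hs).deriv
  exact ⟨m, k, fun s hs => by linarith [hk s hs]⟩

/-- On a rod on which `∂_τ` does not vanish, the boundary value of the flux is affine. -/
theorem IsTodOn.affine_of_ne_zero (hI : IsOpen I) (hIc : I.OrdConnected) (hT : IsTodOn c v h W F I)
    {f α : ℝ → ℝ} {F₀ : ℝ} (hf : ∀ s ∈ I, 0 < f s) (hα : ∀ s ∈ I, 0 < α s)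
    (hu : ∀ s ∈ I, Tendsto (flux v) (axisNhds s) (𝓝 (f s)))
    (hW : ∀ s ∈ I, Tendsto (fun q => (W q)⁻¹) (axisNhds s) (𝓝 (α s)))
    (hF : ∀ s ∈ I, Tendsto (fun q => F q * (W q)⁻¹) (axisNhds s) (𝓝 (F₀ * α s))) :
    ∃ m k : ℝ, ∀ s ∈ I, f s = m * s + k := by
  have hk : ∀ s ∈ I, ∃ k, Tendsto h (axisNhds s) (𝓝 k)
      ∧ Tendsto (fun q => 1 / 2 * q.1 * d2 v q + h q) (axisNhds s) (𝓝 k) := fun s hs =>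
    hT.harm.exists_tendsto_conjugate hI hs (hu s hs) hT.smooth_conj hT.conj1
  choose! k hk1 hk2 using hk
  have hk' : ∀ s ∈ I, HasDerivAt k (2 * f s) s := fun s hs => by
    refine hasDerivAt_of_tendsto_axis (Q' := fun s => 2 * f s) hI hT.smooth_conj hk1
      (fun x hx => ?_) hs
    refine ((hu x hx).const_mul 2).congr' ?_
    filter_upwards [axisNhds_mem_strip hI hx] with q hq using (hT.conj2 q hq).symm
  refine affine_of_ode (N := fun s => k s + c * F₀) hI hIc hf (continuousOn_of_tendsto_axis hI hu)
    (fun s hs => (hk' s hs).add_const _) fun s hs hN => ?_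
  -- near `s` the function `k + c F₀` does not vanish, so that the limit of `u_s` is available
  set J := I ∩ {x | k x + c * F₀ ≠ 0} with hJ
  have hJo : IsOpen J := by
    have hc : ContinuousOn (fun x => k x + c * F₀) I := fun x hx =>
      ((hk' x hx).add_const _).continuousAt.continuousWithinAt
    exact hc.isOpen_inter_preimage hI isOpen_ne
  exact hasDerivAt_of_tendsto_axis (Q' := fun s => f s ^ 2 / (k s + c * F₀)) hJo
    ((hT.harm.isFluxOn hI).smooth.mono (prod_mono le_rfl inter_subset_left))
    (fun x hx => hu x hx.1) (fun x hx => hT.tendsto_d2_flux hI hx.1 (hf x hx.1) (hα x hx.1) hx.2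
      (hu x hx.1) (hk2 x hx.1) (hW x hx.1) (hF x hx.1)) ⟨hs, hN⟩

/-- On a rod on which `∂_τ` vanishes, the boundary value of the flux is constant. -/
theorem IsTodOn.const_of_eq_zero (hI : IsOpen I) (hIc : I.OrdConnected) (hT : IsTodOn c v h W F I)
    {f β : ℝ → ℝ} (hf : ∀ s ∈ I, 0 < f s) (hβ : ∀ s ∈ I, 0 < β s)
    (hu : ∀ s ∈ I, Tendsto (flux v) (axisNhds s) (𝓝 (f s)))
    (hW : ∀ s ∈ I, Tendsto (fun q => (W q)⁻¹) (axisNhds s) (𝓝 0))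
    (hF : ∀ s ∈ I, Tendsto (fun q => F q * (W q)⁻¹) (axisNhds s) (𝓝 0))
    (hG : ∀ s ∈ I, Tendsto (fun q => F q ^ 2 * (W q)⁻¹ + W q * q.1) (axisNhds s) (𝓝 (β s))) :
    ∃ k : ℝ, ∀ s ∈ I, f s = k := by
  have hd : ∀ s ∈ I, HasDerivAt f 0 s := fun s hs => by
    refine hasDerivAt_of_tendsto_axis (Q' := fun _ => 0) hI (hT.harm.isFluxOn hI).smooth hu
      (fun x hx => ?_) hs
    obtain ⟨k, -, hk⟩ := hT.harm.exists_tendsto_conjugate hI hx (hu x hx) hT.smooth_conj hT.conj1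
    exact hT.tendsto_d2_flux_zero hI hx (hf x hx) (hβ x hx) (hu x hx) hk (hW x hx) (hF x hx)
      (hG x hx)
  exact hI.exists_is_const_of_deriv_eq_zero hIc.isPreconnected
    (fun s hs => (hd s hs).differentiableAt.differentiableWithinAt) fun s hs => (hd s hs).deriv

end ToricInstanton

namespace ToricInstanton

open Set Filter

variable {V H : ℝ → ℝ → ℝ} {c r s : ℝ} {q : ℝ × ℝ}

/-! ### Passage to the coordinates `(ρ², ζ)` -/

/-- The function `V(ρ, ζ)` in the coordinates `(t, s) = (ρ², ζ)`. -/
noncomputable def pullSqrt (V : ℝ → ℝ → ℝ) (q : ℝ × ℝ) : ℝ := V (√q.1) q.2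

lemma pullSqrt_sq (V : ℝ → ℝ → ℝ) (hr : 0 ≤ r) (s : ℝ) : pullSqrt V (r ^ 2, s) = V r s := by
  simp [pullSqrt, Real.sqrt_sq hr]

lemma contDiffOn_pullSqrt (hV : ContDiffOn ℝ ∞ (fun q : ℝ × ℝ => V q.1 q.2) halfPlane) :
    ContDiffOn ℝ ∞ (pullSqrt V) (strip univ) := by
  have h1 : ContDiffOn ℝ ∞ (fun q : ℝ × ℝ => (√q.1, q.2)) (strip univ) :=
    ((contDiffOn_fst.sqrt fun q hq => (ne_of_gt hq.1))).prodMk contDiffOn_snd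
  exact hV.comp h1 fun q hq => Real.sqrt_pos.2 hq.1

lemma hasDerivAt_comp_sq {F : ℝ × ℝ → ℝ} (hF : DifferentiableAt ℝ F (r ^ 2, s)) :
    HasDerivAt (fun r' => F (r' ^ 2, s)) (2 * r * d1 F (r ^ 2, s)) r := by
  refine (HasDerivAt.comp (h := fun x : ℝ => x ^ 2) (h₂ := fun x => F (x, s)) r (hasDerivAt_d1 hF)
    (hasDerivAt_pow 2 r)).congr_deriv ?_
  push_cast
  ring

lemma dRho_eq (hV : ContDiffOn ℝ ∞ (pullSqrt V) (strip univ)) (hr : 0 < r) :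
    dRho V r s = 2 * r * d1 (pullSqrt V) (r ^ 2, s) := by
  have h2 := hasDerivAt_comp_sq (differentiableAt_of_contDiffOn (isOpen_strip isOpen_univ) hV
    (show (r ^ 2, s) ∈ strip univ from ⟨pow_pos hr 2, mem_univ _⟩))
  have h3 : HasDerivAt (fun r' => V r' s) (2 * r * d1 (pullSqrt V) (r ^ 2, s)) r := by
    refine h2.congr_of_eventuallyEq ?_
    filter_upwards [lt_mem_nhds hr] with r' hr' using (pullSqrt_sq V hr'.le s).symm
  exact h3.deriv

lemma dZeta_eq (hV : ContDiffOn ℝ ∞ (pullSqrt V) (strip univ)) (hr : 0 < r) :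
    dZeta V r s = d2 (pullSqrt V) (r ^ 2, s) := by
  have h1 := hasDerivAt_d2 (differentiableAt_of_contDiffOn (isOpen_strip isOpen_univ) hV
    (show (r ^ 2, s) ∈ strip univ from ⟨pow_pos hr 2, mem_univ _⟩))
  rw [← h1.deriv, dZeta]
  simp only [pullSqrt_sq V hr.le]

lemma pullSqrt_dZeta (hV : ContDiffOn ℝ ∞ (pullSqrt V) (strip univ)) :
    EqOn (pullSqrt (dZeta V)) (d2 (pullSqrt V)) (strip univ) := by
  rintro ⟨t, s⟩ ⟨ht, -⟩
  have ht : 0 < t := ht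
  have h := dZeta_eq (s := s) hV (Real.sqrt_pos.2 ht)
  rw [Real.sq_sqrt ht.le] at h
  exact h

lemma IsAxisymmetricHarmonic.isHarmOn (hV : IsAxisymmetricHarmonic V) :
    IsHarmOn (pullSqrt V) univ where
  smooth := contDiffOn_pullSqrt hV.smooth
  eq := by
    rintro ⟨t, s⟩ hq
    have ht : 0 < t := hq.1
    have hU := isOpen_strip isOpen_univ
    have hs := contDiffOn_pullSqrt hV.smooth
    have hs2 : ContDiffOn ℝ ∞ (pullSqrt (dZeta V)) (strip univ) :=
      (contDiffOn_d2 hU hs).congr (pullSqrt_dZeta hs)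
    set r := √t with hrdef
    have hr : 0 < r := Real.sqrt_pos.2 ht
    have hrt : r ^ 2 = t := Real.sq_sqrt ht.le
    have hL := hV.laplace r s hr
    rw [dZeta_eq hs2 hr, hrt, d2_congr hU (pullSqrt_dZeta hs) hq] at hL
    have hflux : ContDiffOn ℝ ∞ (flux (pullSqrt V)) (strip univ) :=
      contDiff_fst.contDiffOn.mul (contDiffOn_d1 hU hs)
    have h2 := (hasDerivAt_comp_sq (r := r) (s := s) (F := flux (pullSqrt V)) (by
      rw [hrt]; exact differentiableAt_of_contDiffOn hU hflux hq)).const_mul 2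
    have h3 : HasDerivAt (fun r' => r' * dRho V r' s)
        (4 * r * d1 (flux (pullSqrt V)) (t, s)) r := by
      refine (h2.congr_of_eventuallyEq ?_).congr_deriv (by rw [hrt]; ring)
      filter_upwards [lt_mem_nhds hr] with r' hr'
      rw [dRho_eq hs hr']
      simp only [flux]
      ring
    have h4 : d1 (flux (pullSqrt V)) (t, s)
        = d1 (pullSqrt V) (t, s) + t * d1 (d1 (pullSqrt V)) (t, s) :=
      d1_fst_mul (differentiableAt_of_contDiffOn hU (contDiffOn_d1 hU hs) hq)
    rw [h3.deriv, h4] at hL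
    have h5 : 1 / r * (4 * r * (d1 (pullSqrt V) (t, s) + t * d1 (d1 (pullSqrt V)) (t, s)))
        = 4 * (t * d1 (d1 (pullSqrt V)) (t, s) + d1 (pullSqrt V) (t, s)) := by
      field_simp
      ring
    rw [h5] at hL
    exact hL

lemma flux_pullSqrt (hV : IsAxisymmetricHarmonic V) (hr : 0 < r) :
    flux (pullSqrt V) (r ^ 2, s) = 1 / 2 * r * dRho V r s := by
  rw [dRho_eq (contDiffOn_pullSqrt hV.smooth) hr, flux]
  ring

lemma todD_eq (hV : IsAxisymmetricHarmonic V) (hr : 0 < r) :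
    todD V r s = 4 / r ^ 2 * gradSq (flux (pullSqrt V)) (r ^ 2, s) ∧
    dZeta (dZeta V) r s = -4 * d1 (flux (pullSqrt V)) (r ^ 2, s) ∧
    dRho (dZeta V) r s = 2 / r * d2 (flux (pullSqrt V)) (r ^ 2, s) := by
  have hU := isOpen_strip isOpen_univ
  have hs := contDiffOn_pullSqrt hV.smooth
  have hs2 : ContDiffOn ℝ ∞ (pullSqrt (dZeta V)) (strip univ) :=
    (contDiffOn_d2 hU hs).congr (pullSqrt_dZeta hs)
  have hq : (r ^ 2, s) ∈ strip univ := ⟨pow_pos hr 2, mem_univ _⟩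
  have e1 : dZeta (dZeta V) r s = -4 * d1 (flux (pullSqrt V)) (r ^ 2, s) := by
    rw [dZeta_eq hs2 hr, d2_congr hU (pullSqrt_dZeta hs) hq, d1_flux isOpen_univ hV.isHarmOn hq]
    ring
  have e2 : dRho (dZeta V) r s = 2 / r * d2 (flux (pullSqrt V)) (r ^ 2, s) := by
    rw [dRho_eq hs2 hr, d1_congr hU (pullSqrt_dZeta hs) hq, d2_flux isOpen_univ hV.isHarmOn hq]
    field_simp
  refine ⟨?_, e1, e2⟩
  rw [todD, e1, e2, gradSq]
  field_simp
  ring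

/-- The Tod form in the coordinates `(ρ², ζ)`. -/
lemma IsAxisymmetricHarmonic.isTodOn (hV : IsAxisymmetricHarmonic V)
    (hH : IsHarmonicConjugate V H) (hc : c ≠ 0) (hW : ∀ r s, 0 < r → 0 < todW c V r s) :
    IsTodOn c (pullSqrt V) (pullSqrt H) (pullSqrt (todW c V)) (pullSqrt (todF c V H)) univ := by
  have hs := contDiffOn_pullSqrt hV.smooth
  have hsH := contDiffOn_pullSqrt hH.smooth
  -- write a point `(t, s)` of the strip as `(r ^ 2, s)`
  have key {P : ℝ × ℝ → Prop} (h : ∀ r s, 0 < r → P (r ^ 2, s)) : ∀ q ∈ strip univ, P q := by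
    rintro ⟨t, s⟩ ⟨ht, -⟩
    have ht : 0 < t := ht
    have := h (√t) s (Real.sqrt_pos.2 ht)
    rwa [Real.sq_sqrt ht.le] at this
  refine ⟨hc, hV.isHarmOn, hsH, key fun r s hr => ?_, key fun r s hr => ?_, key fun r s hr => ?_,
    key fun r s hr => ?_, key fun r s hr => ?_⟩
  · have h1 := hH.rho r s hr
    rw [dRho_eq hsH hr, dZeta_eq hs hr] at h1
    refine mul_left_cancel₀ (mul_pos two_pos hr).ne' ?_
    linarith
  · have h1 := hH.zeta r s hr
    rw [dZeta_eq hsH hr] at h1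
    rw [h1, flux_pullSqrt hV hr]
    ring
  · rw [pullSqrt_sq _ hr.le]
    exact hW r s hr
  · obtain ⟨e1, e2, -⟩ := todD_eq (s := s) hV hr
    rw [pullSqrt_sq _ hr.le, todW, e1, e2, dRho_eq hs hr, flux]
    rcases eq_or_ne (gradSq (flux (pullSqrt V)) (r ^ 2, s)) 0 with h0 | h0
    · simp only [h0, mul_zero, div_zero]
      field_simp
      ring
    · unfold flux at h0 ⊢
      field_simp
      ring
  · obtain ⟨e1, -, e2⟩ := todD_eq (s := s) hV hr
    rw [pullSqrt_sq _ hr.le, pullSqrt_sq _ hr.le, todF, e1, e2, dRho_eq hs hr, dZeta_eq hs hr]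
    rcases eq_or_ne (gradSq (flux (pullSqrt V)) (r ^ 2, s)) 0 with h0 | h0
    · simp only [h0, mul_zero, div_zero]
      field_simp
      ring
    · unfold flux at h0 ⊢
      field_simp
      ring

end ToricInstanton

namespace ToricInstanton

open Set Filter

/-! ### Geometry of the torus action -/

section Action

variable {M : Type*} [TopologicalSpace M] [ChartedSpace E4 M] [MulAction Torus M]

lemma torusExp_zero : torusExp 0 = 1 := by simp [torusExp]

lemma contMDiff_torusExp :
    ContMDiff 𝓘(ℝ, ℝ × ℝ) ((𝓡 1).prod (𝓡 1)) ∞ torusExp := by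
  have h1 : ContMDiff 𝓘(ℝ, ℝ × ℝ) 𝓘(ℝ, ℝ) ∞ (Prod.fst : ℝ × ℝ → ℝ) := contDiff_fst.contMDiff
  have h2 : ContMDiff 𝓘(ℝ, ℝ × ℝ) 𝓘(ℝ, ℝ) ∞ (Prod.snd : ℝ × ℝ → ℝ) := contDiff_snd.contMDiff
  exact (contMDiff_circleExp.comp h1).prodMk (contMDiff_circleExp.comp h2)

lemma contMDiff_orbit [ContMDiffSMul ((𝓡 1).prod (𝓡 1)) (𝓡 4) ∞ Torus M] (p : M) :
    ContMDiff 𝓘(ℝ, ℝ × ℝ) (𝓡 4) ∞ (fun x : ℝ × ℝ => torusExp x • p) :=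
  (ContMDiffSMul.contMDiff_smul (I := (𝓡 1).prod (𝓡 1)) (I' := 𝓡 4) (n := ∞)).comp
    (contMDiff_torusExp.prodMk contMDiff_const)

/-- The generating vector field as the value of the differential of the orbit map; in particular it
is linear in the element of the Lie algebra. -/
lemma fundField_eq [ContMDiffSMul ((𝓡 1).prod (𝓡 1)) (𝓡 4) ∞ Torus M] (a : ℝ × ℝ) (p : M) :
    (fundField a p : E4) = mfderiv 𝓘(ℝ, ℝ × ℝ) (𝓡 4) (fun x : ℝ × ℝ => torusExp x • p) 0 a := by
  have h1 : HasMFDerivAt 𝓘(ℝ, ℝ) 𝓘(ℝ, ℝ × ℝ) (fun t : ℝ => t • a) 0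
      (ContinuousLinearMap.toSpanSingleton ℝ a) :=
    (ContinuousLinearMap.toSpanSingleton ℝ a).hasFDerivAt.hasMFDerivAt
  have h2 := (contMDiff_orbit p).mdifferentiable (by simp) (0 : ℝ × ℝ)
  have h3 := mfderiv_comp_apply_of_eq 0 h2 h1.mdifferentiableAt (zero_smul ℝ a) (1 : ℝ)
  rw [h1.mfderiv] at h3
  refine h3.trans (congrArg _ ?_)
  exact one_smul ℝ a

lemma fundField_lin [ContMDiffSMul ((𝓡 1).prod (𝓡 1)) (𝓡 4) ∞ Torus M] (α β : ℝ) (a b : ℝ × ℝ)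
    (p : M) : fundField (α • a + β • b) p = α • fundField a p + β • fundField b p := by
  let L : ℝ × ℝ →L[ℝ] E4 := mfderiv 𝓘(ℝ, ℝ × ℝ) (𝓡 4) (fun x : ℝ × ℝ => torusExp x • p) 0
  have hL : ∀ x, (fundField x p : E4) = L x := fun x => fundField_eq x p
  have h : L (α • a + β • b) = α • L a + β • L b := by rw [map_add, map_smul, map_smul]
  rw [← hL, ← hL, ← hL] at h
  exact h

/-- An invariant function is constant along the generating fields. (Where it is not differentiable,
`dform` is zero by convention.) -/
lemma dform_fundField [ContMDiffSMul ((𝓡 1).prod (𝓡 1)) (𝓡 4) ∞ Torus M] {f : M → ℝ}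
    (hf : ∀ (t : Torus) p, f (t • p) = f p) (a : ℝ × ℝ) (p : M) :
    dform f p (fundField a p) = 0 := by
  by_cases hd : MDifferentiableAt (𝓡 4) 𝓘(ℝ, ℝ) f p
  · have h0 : torusExp ((0 : ℝ) • a) • p = p := by rw [zero_smul, torusExp_zero, one_smul]
    have hc : MDifferentiableAt 𝓘(ℝ, ℝ) (𝓡 4) (fun t : ℝ => torusExp (t • a) • p) 0 :=
      ((contMDiff_orbit p).comp (contDiff_id.smul contDiff_const : ContDiff ℝ ∞
        fun t : ℝ => t • a).contMDiff).mdifferentiable (by simp) 0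
    have h1 := mfderiv_comp_apply_of_eq (I'' := 𝓘(ℝ, ℝ)) (y := p) 0 hd hc h0 (1 : ℝ)
    have h2 : f ∘ (fun t : ℝ => torusExp (t • a) • p) = fun _ => f p := by
      funext t; exact hf _ _
    rw [h2, mfderiv_const] at h1
    exact h1.symm
  · rw [dform, mfderiv_zero_of_not_mdifferentiableAt hd]
    rfl

lemma push_fundField [ContMDiffSMul ((𝓡 1).prod (𝓡 1)) (𝓡 4) ∞ Torus M] (t : Torus) (a : ℝ × ℝ)
    (p : M) : push t p (fundField a p) = fundField a (t • p) := by
  have h0 : torusExp ((0 : ℝ) • a) • p = p := by rw [zero_smul, torusExp_zero, one_smul]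
  have hc : MDifferentiableAt 𝓘(ℝ, ℝ) (𝓡 4) (fun x : ℝ => torusExp (x • a) • p) 0 :=
    ((contMDiff_orbit p).comp (contDiff_id.smul contDiff_const : ContDiff ℝ ∞
      fun x : ℝ => x • a).contMDiff).mdifferentiable (by simp) 0
  have hd : MDifferentiableAt (𝓡 4) (𝓡 4) (fun q : M => t • q) p :=
    ((ContMDiffSMul.contMDiff_smul (I := (𝓡 1).prod (𝓡 1)) (I' := 𝓡 4) (n := ∞)).comp
      (contMDiff_const.prodMk contMDiff_id) : ContMDiff (𝓡 4) (𝓡 4) ∞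
        fun q : M => t • q).mdifferentiable (by simp) p
  have h1 := mfderiv_comp_apply_of_eq (y := p) 0 hd hc h0 (1 : ℝ)
  have h2 : (fun q : M => t • q) ∘ (fun x : ℝ => torusExp (x • a) • p)
      = fun x : ℝ => torusExp (x • a) • (t • p) := by
    funext x
    simp only [Function.comp]
    rw [smul_smul, smul_smul, mul_comm]
  rw [h2] at h1
  exact h1.symm

lemma tangentBundle_mk_eq {M : Type*} [TopologicalSpace M] [ChartedSpace E4 M]
    {x y : M} (h : x = y) (w : E4) :
    (⟨x, w⟩ : TangentBundle (𝓡 4) M) = ⟨y, w⟩ := by subst h; rfl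

lemma continuous_fundField [IsManifold (𝓡 4) ∞ M]
    [ContMDiffSMul ((𝓡 1).prod (𝓡 1)) (𝓡 4) ∞ Torus M] (a : ℝ × ℝ) :
    Continuous fun p : M => (⟨p, fundField a p⟩ : TangentBundle (𝓡 4) M) := by
  have : IsManifold (𝓡 4) 1 M := IsManifold.of_le (n := ∞) (by simp)
  have hΦ : ContMDiff (𝓘(ℝ, ℝ).prod (𝓡 4)) (𝓡 4) ∞
      (fun q : ℝ × M => torusExp (q.1 • a) • q.2) := by
    have h1 : ContMDiff 𝓘(ℝ, ℝ) 𝓘(ℝ, ℝ × ℝ) ∞ (fun t : ℝ => t • a) :=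
      (contDiff_id.smul contDiff_const).contMDiff
    exact (ContMDiffSMul.contMDiff_smul (I := (𝓡 1).prod (𝓡 1)) (I' := 𝓡 4) (n := ∞)).comp
      (((contMDiff_torusExp.comp h1).comp contMDiff_fst).prodMk contMDiff_snd)
  have hT : Continuous (tangentMap (𝓘(ℝ, ℝ).prod (𝓡 4)) (𝓡 4)
      (fun q : ℝ × M => torusExp (q.1 • a) • q.2)) :=
    (hΦ.contMDiff_tangentMap (m := 0) (by simp)).continuous
  have hS : Continuous fun p : M => (equivTangentBundleProd 𝓘(ℝ, ℝ) ℝ (𝓡 4) M).symm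
      ((⟨(0 : ℝ), (1 : ℝ)⟩ : TangentBundle 𝓘(ℝ, ℝ) ℝ),
        zeroSection E4 (TangentSpace (𝓡 4) : M → Type _) p) :=
    (contMDiff_equivTangentBundleProd_symm (n := 0)).continuous.comp
      (continuous_const.prodMk (contMDiff_zeroSection (IB := 𝓡 4) (n := 0) ℝ
        (TangentSpace (𝓡 4) : M → Type _)).continuous)
  refine (hT.comp hS).congr fun p => ?_
  have h0 : torusExp ((0 : ℝ) • a) • p = p := by rw [zero_smul, torusExp_zero, one_smul]
  have hd := mfderiv_prod_eq_add_apply (p := ((0 : ℝ), p)) (v := ((1 : ℝ), (0 : E4)))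
    (hΦ.mdifferentiable (by simp) (0, p))
  refine Eq.trans ?_ (tangentBundle_mk_eq h0 (fundField a p))
  simp only [Function.comp, tangentMap]
  congr 1
  refine hd.trans ?_
  erw [map_zero, add_zero]
  rfl

end Action

end ToricInstanton

namespace ToricInstanton

open Set Filter

/-! ### Invariant functions on the orbit space -/

section Geometry

variable {M : Type*} [MetricSpace M] [ChartedSpace E4 M]
  [RiemannianBundle (fun x : M => TangentSpace (𝓡 4) x)] [MulAction Torus M]
  {J : EndField M} {Ω : M → ℝ} {a b : ℝ × ℝ} {c : ℝ} {V H : ℝ → ℝ → ℝ}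

/-- The entry `g(X_a, X_b)` of the Gram matrix of the vector fields generated by `a` and `b`. -/
noncomputable def gram (a b : ℝ × ℝ) (p : M) : ℝ := inner ℝ (fundField a p) (fundField b p)

lemma continuous_gram [IsManifold (𝓡 4) ∞ M]
    [IsContMDiffRiemannianBundle (𝓡 4) ∞ E4 (fun x : M => TangentSpace (𝓡 4) x)]
    (hM : IsToricInstanton M) (a b : ℝ × ℝ) : Continuous (gram a b : M → ℝ) := by
  have := hM.smooth_action
  have : IsContinuousRiemannianBundle E4 (fun x : M => TangentSpace (𝓡 4) x) := by
    obtain ⟨g, hg, h⟩ := IsContMDiffRiemannianBundle.exists_contMDiff (IB := 𝓡 4) (n := ∞)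
      (F := E4) (E := fun x : M => TangentSpace (𝓡 4) x)
    exact ⟨g, hg.continuous, h⟩
  exact (continuous_fundField a).inner_bundle (continuous_fundField b)

lemma gram_smul (hM : IsToricInstanton M) (a b : ℝ × ℝ) (t : Torus) (p : M) :
    gram a b (t • p) = gram a b p := by
  have := hM.smooth_action
  rw [gram, ← push_fundField, ← push_fundField, hM.isometric, gram]

/-- The conformal factor is invariant, since the torus acts by isometries of both `g` and `Ω² g`. -/
lemma conformalFactor_smul (hM : IsToricHermitianInstanton M J Ω) (t : Torus) (p : M) :
    Ω (t • p) = Ω p := by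
  obtain ⟨v, hv⟩ : ∃ v : TangentSpace (𝓡 4) p, v ≠ 0 :=
    exists_ne (α := E4) 0
  have h := hM.toricKahler.isometric t p v v
  rw [hM.toric.isometric] at h
  have h1 : (0 : ℝ) < inner ℝ v v := real_inner_self_pos.2 hv
  have h2 := mul_right_cancel₀ h1.ne' h
  exact (pow_left_inj₀ (hM.conformallyKahler.pos _).le (hM.conformallyKahler.pos _).le
    two_ne_zero).1 h2

lemma RodStructure.weylRho_smul (R : RodStructure M a b) (t : Torus) (p : M) :
    weylRho a b (t • p) = weylRho a b p ∧ R.ζ (t • p) = R.ζ p := by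
  obtain ⟨e, he⟩ := R.orbitSpace
  have h : (Quotient.mk (MulAction.orbitRel Torus M) (t • p)) = Quotient.mk _ p :=
    Quotient.sound (MulAction.mem_orbit p t)
  have h1 := he (t • p)
  rw [h, he p] at h1
  exact ⟨(congrArg Prod.fst h1).symm, (congrArg Prod.snd h1).symm⟩

lemma RodStructure.exists_point (R : RodStructure M a b) {r : ℝ} (hr : 0 ≤ r) (s : ℝ) :
    ∃ p : M, weylRho a b p = r ∧ R.ζ p = s := by
  obtain ⟨e, he⟩ := R.orbitSpace
  obtain ⟨p, hp⟩ := Quotient.exists_rep (e.symm ⟨(r, s), hr⟩)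
  have h := he p
  rw [hp, e.apply_symm_apply] at h
  exact ⟨p, (congrArg Prod.fst h).symm, (congrArg Prod.snd h).symm⟩

/-- A continuous invariant function on `M` is a continuous function of `(ρ, ζ)` on the closed
half-plane. -/
lemma RodStructure.exists_descend (R : RodStructure M a b) {φ : M → ℝ} (hφ : Continuous φ)
    (hinv : ∀ (t : Torus) p, φ (t • p) = φ p) :
    ∃ Φ : ℝ × ℝ → ℝ, ContinuousOn Φ {q | 0 ≤ q.1} ∧
      ∀ p, Φ (weylRho a b p, R.ζ p) = φ p := by
  classical
  obtain ⟨e, he⟩ := R.orbitSpace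
  have hlift : ∀ p q : M, MulAction.orbitRel Torus M p q → φ p = φ q := by
    rintro p q ⟨t, rfl⟩
    exact hinv t q
  have hc : Continuous (Quotient.lift φ hlift) := hφ.quotient_lift hlift
  refine ⟨fun q => if h : 0 ≤ q.1 then Quotient.lift φ hlift (e.symm ⟨q, h⟩) else 0, ?_,
    fun p => ?_⟩
  · rw [continuousOn_iff_continuous_domRestrict]
    refine (hc.comp e.symm.continuous).congr fun q => ?_
    have hq : 0 ≤ (q : ℝ × ℝ).1 := q.2
    simp only [Function.comp, domRestrict_apply]
    rw [dif_pos hq]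
  · have h0 : 0 ≤ weylRho a b p := Real.sqrt_nonneg _
    dsimp only
    rw [dif_pos h0]
    have : (⟨(weylRho a b p, R.ζ p), h0⟩ : {q : ℝ × ℝ // 0 ≤ q.1}) = e (Quotient.mk _ p) :=
      Subtype.ext (he p).symm
    rw [this, e.symm_apply_apply]
    rfl

lemma tendsto_sqrt_axis {Φ : ℝ × ℝ → ℝ} (hΦ : ContinuousOn Φ {q | 0 ≤ q.1}) (s : ℝ) :
    Tendsto (fun q : ℝ × ℝ => Φ (√q.1, q.2)) (axisNhds s) (𝓝 (Φ (0, s))) := by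
  have h1 : Tendsto (fun q : ℝ × ℝ => (√q.1, q.2)) (axisNhds s) (𝓝[{q | 0 ≤ q.1}] (0, s)) := by
    refine tendsto_nhdsWithin_iff.2 ⟨?_, Eventually.of_forall fun q => Real.sqrt_nonneg _⟩
    refine Tendsto.prodMk_nhds ?_ tendsto_snd
    have := (Real.continuous_sqrt.tendsto 0).comp (tendsto_fst_axis (s₀ := s))
    rw [Real.sqrt_zero] at this
    exact this
  exact (hΦ (0, s) (le_refl (0 : ℝ))).tendsto.comp h1

/-- The Gram matrix of the Killing fields, read off from the Tod form: `dρ` and `dζ` vanish on the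
orbits. -/
lemma gram_of_isTodFormOn (hM : IsToricInstanton M) (R : RodStructure M a b) {τ y : M → ℝ}
    {U : Set M} (h : IsTodFormOn J a b R.ζ c V H τ y U) {p : M} (hp : p ∈ U) :
    gram a a p = (todW c V (weylRho a b p) (R.ζ p))⁻¹ ∧
    gram a b p = todF c V H (weylRho a b p) (R.ζ p) * (todW c V (weylRho a b p) (R.ζ p))⁻¹ ∧
    gram b b p = todF c V H (weylRho a b p) (R.ζ p) ^ 2 * (todW c V (weylRho a b p) (R.ζ p))⁻¹
      + todW c V (weylRho a b p) (R.ζ p) * weylRho a b p ^ 2 := by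
  have := hM.smooth_action
  have ρ0 (u : ℝ × ℝ) : dform (weylRho a b) p (fundField u p) = 0 :=
    dform_fundField (fun t q => (R.weylRho_smul t q).1) u p
  have ζ0 (u : ℝ × ℝ) : dform R.ζ p (fundField u p) = 0 :=
    dform_fundField (fun t q => (R.weylRho_smul t q).2) u p
  obtain ⟨a1, a2⟩ := h.partial_tau p hp
  obtain ⟨b1, b2⟩ := h.partial_y p hp
  have m1 := h.metric p hp (fundField a p) (fundField a p)
  have m2 := h.metric p hp (fundField a p) (fundField b p)
  have m3 := h.metric p hp (fundField b p) (fundField b p)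
  simp only [ρ0, ζ0, a1, a2, b1, b2] at m1 m2 m3
  refine ⟨m1.trans ?_, m2.trans ?_, m3.trans ?_⟩ <;> ring

lemma todW_pos (hM : IsToricInstanton M) (R : RodStructure M a b) {τ y : M → ℝ}
    {U : Set M} (h : IsTodFormOn J a b R.ζ c V H τ y U) {p : M} (hp : p ∈ U)
    (hρ : 0 < weylRho a b p) : 0 < todW c V (weylRho a b p) (R.ζ p) := by
  obtain ⟨h1, h2, h3⟩ := gram_of_isTodFormOn hM R h hp
  have h0 : 0 ≤ gram a a p := real_inner_self_nonneg
  rw [h1, inv_nonneg] at h0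
  refine lt_of_le_of_ne h0 fun hz => ?_
  -- if `W` vanished then so would the Gram matrix, in contradiction to `ρ > 0`
  rw [← hz] at h1 h2 h3
  have : weylRho a b p = √(gram a a p * gram b b p - gram a b p ^ 2) := rfl
  rw [h1, h2, h3] at this
  simp at this
  exact hρ.ne' this

/-- On each rod either `∂_τ` vanishes, or `∂_y` is a constant multiple of `∂_τ`. -/
lemma RodStructure.gram_on_rod (hM : IsToricInstanton M) (R : RodStructure M a b)
    (i : Fin (R.n + 1)) :
    (∀ p : M, weylRho a b p = 0 → R.ζ p ∈ rod R.z i →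
      gram a a p = 0 ∧ gram a b p = 0 ∧ 0 < gram b b p) ∨
    ∃ F₀ : ℝ, ∀ p : M, weylRho a b p = 0 → R.ζ p ∈ rod R.z i →
      0 < gram a a p ∧ gram a b p = F₀ * gram a a p := by
  have := hM.smooth_action
  have hli := LinearIndependent.pair_iff.1 R.basis
  by_cases ha : ∃ x : ℝ, a = x • R.v i
  · left
    intro p hp hz
    have hk := R.kernel i p hp hz
    have ha0 : fundField a p = 0 := (hk a).2 ha
    have hb0 : fundField b p ≠ 0 := by
      intro h
      obtain ⟨x, hx⟩ := ha
      obtain ⟨y, hy⟩ := (hk b).1 h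
      have e : y • a + (-x) • b = 0 := by
        refine (congrArg₂ (fun u w => y • u + (-x) • w) hx hy).trans ?_
        simp only [smul_smul, ← add_smul]
        rw [show y * x + -x * y = 0 by ring, zero_smul]
      obtain ⟨-, h2⟩ := hli y (-x) e
      have hz : a = 0 := hx.trans (by rw [neg_eq_zero.1 h2, zero_smul])
      have := hli 1 0 ((congrArg (fun u => (1 : ℝ) • u + (0 : ℝ) • b) hz).trans (by simp))
      exact one_ne_zero this.1
    refine ⟨?_, ?_, real_inner_self_pos.2 hb0⟩ <;> simp [gram, ha0]
  · right
    -- coordinates of the rod vector in the basis `a`, `b`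
    obtain ⟨α, β, hv⟩ : ∃ α β : ℝ, α • a + β • b = R.v i := by
      have hspan := R.basis.span_eq_top_of_card_eq_finrank (by simp)
      have : R.v i ∈ Submodule.span ℝ (range ![a, b]) := by rw [hspan]; trivial
      rw [Matrix.range_cons, Matrix.range_cons, Matrix.range_empty, union_empty,
        singleton_union] at this
      exact Submodule.mem_span_pair.1 this
    have hβ : β ≠ 0 := by
      rintro rfl
      rw [zero_smul, add_zero] at hv
      have hα : α ≠ 0 := by
        rintro rfl
        exact R.v_ne_zero i (by rw [← hv, zero_smul])
      exact ha ⟨α⁻¹, by rw [← hv, smul_smul, inv_mul_cancel₀ hα, one_smul]⟩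
    refine ⟨-α / β, fun p hp hz => ?_⟩
    have hk := R.kernel i p hp hz
    have ha0 : fundField a p ≠ 0 := fun h => ha ((hk a).1 h)
    have h0 : fundField (R.v i) p = 0 := (hk _).2 ⟨1, (one_smul _ _).symm⟩
    rw [← hv, fundField_lin] at h0
    refine ⟨real_inner_self_pos.2 ha0, ?_⟩
    have h1 : inner ℝ (fundField a p) (α • fundField a p + β • fundField b p) = (0 : ℝ) := by
      rw [h0, inner_zero_right]
    rw [inner_add_right, real_inner_smul_right, real_inner_smul_right] at h1
    rw [gram, gram]
    field_simp
    linarith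

end Geometry

end ToricInstanton

namespace ToricInstanton

open Set Filter

/-! ### Subtraction of the logarithmic part -/

section Log

variable {v h W F : ℝ × ℝ → ℝ} {I I' : Set ℝ} {c m k : ℝ} {q : ℝ × ℝ}

lemma IsHarmOn.mono (hv : IsHarmOn v I) (h : I' ⊆ I) : IsHarmOn v I' where
  smooth := hv.smooth.mono (prod_mono le_rfl h)
  eq q hq := hv.eq q ⟨hq.1, h hq.2⟩

lemma IsTodOn.mono (hT : IsTodOn c v h W F I) (hI : I' ⊆ I) : IsTodOn c v h W F I' where
  c_ne_zero := hT.c_ne_zero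
  harm := hT.harm.mono hI
  smooth_conj := hT.smooth_conj.mono (prod_mono le_rfl hI)
  conj1 q hq := hT.conj1 q ⟨hq.1, hI hq.2⟩
  conj2 q hq := hT.conj2 q ⟨hq.1, hI hq.2⟩
  W_pos q hq := hT.W_pos q ⟨hq.1, hI hq.2⟩
  W_eq q hq := hT.W_eq q ⟨hq.1, hI hq.2⟩
  F_eq q hq := hT.F_eq q ⟨hq.1, hI hq.2⟩

lemma d1_sub_affine_mul {G : ℝ × ℝ → ℝ} {g : ℝ → ℝ} {g' : ℝ} (hG : DifferentiableAt ℝ G q)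
    (hg : HasDerivAt g g' q.1) :
    d1 (fun p => G p - (m * p.2 + k) * g p.1) q = d1 G q - (m * q.2 + k) * g' := by
  have hd : DifferentiableAt ℝ (fun p : ℝ × ℝ => G p - (m * p.2 + k) * g p.1) q :=
    hG.sub (((differentiableAt_snd.const_mul m).add_const k).mul
      (hg.differentiableAt.comp q differentiableAt_fst))
  exact (hasDerivAt_d1 hd).unique ((hasDerivAt_d1 hG).sub (hg.const_mul (m * q.2 + k)))

lemma d2_sub_affine_mul {G : ℝ × ℝ → ℝ} {g : ℝ → ℝ} (hG : DifferentiableAt ℝ G q)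
    (hg : DifferentiableAt ℝ g q.1) :
    d2 (fun p => G p - (m * p.2 + k) * g p.1) q = d2 G q - m * g q.1 := by
  have hd : DifferentiableAt ℝ (fun p : ℝ × ℝ => G p - (m * p.2 + k) * g p.1) q :=
    hG.sub (((differentiableAt_snd.const_mul m).add_const k).mul
      (hg.comp q differentiableAt_fst))
  refine (hasDerivAt_d2 hd).unique ((hasDerivAt_d2 hG).sub ?_)
  simpa using (((hasDerivAt_id q.2).const_mul m).add_const k).mul_const (g q.1)

/-- If the flux of `v` through the axis is affine, then it is that of `(m s + k) log t`, which is
harmonic itself; the difference has no flux through the axis. -/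
lemma IsHarmOn.isRegularOn_sub_log (hI : IsOpen I) (hv : IsHarmOn v I)
    (hf : ∀ s ∈ I, Tendsto (flux v) (axisNhds s) (𝓝 (m * s + k))) :
    IsRegularOn (fun q => v q - (m * q.2 + k) * Real.log q.1) I := by
  have hU := isOpen_strip hI
  have D {G : ℝ × ℝ → ℝ} (h : ContDiffOn ℝ ∞ G (strip I)) {q} (hq : q ∈ strip I) :
    DifferentiableAt ℝ G q := differentiableAt_of_contDiffOn hU h hq
  have e1 : EqOn (d1 fun q => v q - (m * q.2 + k) * Real.log q.1)
      (fun q => d1 v q - (m * q.2 + k) * q.1⁻¹) (strip I) := fun q hq =>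
    d1_sub_affine_mul (D hv.smooth hq) (Real.hasDerivAt_log (ne_of_gt hq.1))
  have e2 : EqOn (d2 fun q => v q - (m * q.2 + k) * Real.log q.1)
      (fun q => d2 v q - (0 * q.2 + m) * Real.log q.1) (strip I) := fun q hq => by
    rw [d2_sub_affine_mul (D hv.smooth hq) (Real.hasDerivAt_log (ne_of_gt hq.1)).differentiableAt]
    ring
  refine ⟨⟨?_, fun q hq => ?_⟩, fun s hs => ?_⟩
  · exact hv.smooth.sub (((contDiffOn_const.mul contDiffOn_snd).add contDiffOn_const).mul
      (contDiffOn_fst.log fun q hq => ne_of_gt hq.1))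
  · have hq1 : q.1 ≠ 0 := ne_of_gt hq.1
    rw [d1_congr hU e1 hq, d2_congr hU e2 hq, e1 hq,
      d1_sub_affine_mul (D (contDiffOn_d1 hU hv.smooth) hq) (hasDerivAt_inv hq1),
      d2_sub_affine_mul (D (contDiffOn_d2 hU hv.smooth) hq)
        (Real.hasDerivAt_log hq1).differentiableAt]
    have e := hv.eq q hq
    have e' : q.1 * (q.1 ^ 2)⁻¹ = q.1⁻¹ := by field_simp
    linear_combination e + 4 * (m * q.2 + k) * e'
  · have h2 : Tendsto (fun q : ℝ × ℝ => m * q.2 + k) (axisNhds s) (𝓝 (m * s + k)) :=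
      (tendsto_snd.const_mul m).add_const k
    have h3 := (hf s hs).sub h2
    rw [sub_self] at h3
    refine h3.congr' ?_
    filter_upwards [axisNhds_mem_strip hI hs] with q hq
    have hq1 : q.1 ≠ 0 := ne_of_gt hq.1
    rw [flux, flux, e1 hq]
    field_simp

/-- The expansion along a rod: the regular part is the continuous extension of
`v - (m s + k) log t`. -/
lemma IsHarmOn.exists_expansion (hI : IsOpen I) (hv : IsHarmOn v I)
    (hf : ∀ s ∈ I, Tendsto (flux v) (axisNhds s) (𝓝 (m * s + k))) :
    ∃ G : ℝ × ℝ → ℝ, ContDiffOn ℝ ∞ G (Ici 0 ×ˢ I) ∧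
      ∀ q ∈ strip I, v q = (m * q.2 + k) * Real.log q.1 + G q := by
  refine ⟨_, (hv.isRegularOn_sub_log hI hf).contDiffOn_extendFrom hI, fun q hq => ?_⟩
  have hc : ContinuousAt (fun q => v q - (m * q.2 + k) * Real.log q.1) q :=
    ((hv.isRegularOn_sub_log hI hf).smooth.contDiffAt
      ((isOpen_strip hI).mem_nhds hq)).continuousAt
  rw [extendFrom_eq (subset_closure hq) (hc.tendsto.mono_left nhdsWithin_le_nhds)]
  ring

/-- A function that is smooth up to the axis is locally Lipschitz there. -/
lemma isBigO_sub_axis {G : ℝ × ℝ → ℝ} (hI : IsOpen I) (hIc : I.OrdConnected)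
    (hG : ContDiffOn ℝ ∞ G (Ici 0 ×ˢ I)) {s₀ : ℝ} (hs : s₀ ∈ I) :
    (fun q : ℝ × ℝ => G (q.1 ^ 2, q.2) - G (0, q.2)) =O[axisNhds s₀] fun q => q.1 ^ 2 := by
  have hconv : Convex ℝ (Ici (0 : ℝ) ×ˢ I) := (convex_Ici 0).prod hIc.convex
  obtain ⟨K, T, hT, hK⟩ := ((hG (0, s₀) ⟨le_refl (0 : ℝ), hs⟩).of_le
    (by simp : (1 : WithTop ℕ∞) ≤ ∞)).exists_lipschitzOnWith hconv
  have hT' {x : ℝ × ℝ → ℝ} (hx : Tendsto x (axisNhds s₀) (𝓝 0)) (hx0 : ∀ q, 0 ≤ x q) :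
      ∀ᶠ q in axisNhds s₀, (x q, q.2) ∈ T := by
    refine Tendsto.eventually (tendsto_nhdsWithin_iff.2 ⟨hx.prodMk_nhds tendsto_snd, ?_⟩) hT
    filter_upwards [axisNhds_mem_strip hI hs] with q hq using ⟨hx0 q, hq.2⟩
  have h1 : Tendsto (fun q : ℝ × ℝ => q.1 ^ 2) (axisNhds s₀) (𝓝 0) := by
    simpa using (tendsto_fst_axis (s₀ := s₀)).pow 2
  refine Asymptotics.IsBigO.of_bound K ?_
  filter_upwards [hT' h1 fun q => sq_nonneg _, hT' tendsto_const_nhds fun _ => le_rfl]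
    with q h2 h3
  have h4 := hK.dist_le_mul _ h2 _ h3
  rw [Real.dist_eq] at h4
  refine h4.trans (le_of_eq ?_)
  rw [Prod.dist_eq, dist_self, max_eq_left dist_nonneg, Real.dist_eq, sub_zero, Real.norm_eq_abs]

end Log

/-! ### Rods -/

section Rod

variable {n : ℕ} (z : Fin n → ℝ) (i : Fin (n + 1))

lemma isOpen_rod : IsOpen (rod z i) := by
  have : rod z i = ⋂ j : Fin n, {s | ((j : ℕ) < i → z j < s) ∧ ((i : ℕ) ≤ j → s < z j)} := by
    ext s
    simp [rod]
  rw [this]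
  refine isOpen_iInter_of_finite fun j => ?_
  by_cases h : (j : ℕ) < i
  · convert! isOpen_Ioi (a := z j) using 1
    ext s
    simp only [mem_ofPred_eq, mem_Ioi, h, not_le.2 h, true_implies, false_implies, and_true]
  · convert! isOpen_Iio (a := z j) using 1
    ext s
    simp only [mem_ofPred_eq, mem_Iio, h, not_lt.1 h, true_implies, false_implies, true_and]

lemma ordConnected_rod : (rod z i).OrdConnected :=
  ⟨fun _ hx _ hy _ hs j => ⟨fun h => ((hx j).1 h).trans_le hs.1,
    fun h => hs.2.trans_lt ((hy j).2 h)⟩⟩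

end Rod

end ToricInstanton

namespace ToricInstanton

open Set Filter

/-! ### The flux of the potential is affine along each rod -/

section Flux

variable {M : Type*} [MetricSpace M] [ChartedSpace E4 M] [IsManifold (𝓡 4) ∞ M]
  [RiemannianBundle (fun x : M => TangentSpace (𝓡 4) x)]
  [IsContMDiffRiemannianBundle (𝓡 4) ∞ E4 (fun x : M => TangentSpace (𝓡 4) x)]
  [MulAction Torus M] {J : EndField M} {Ω : M → ℝ} {a b : ℝ × ℝ} {c : ℝ} {V : ℝ → ℝ → ℝ}

/-- The boundary values of `Ω⁻¹ = ½ ρ V_ρ` on the axis: they are continuous and positive, since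
`Ω` is smooth and positive on all of `M`, and affine on every rod. -/
theorem exists_flux (hM : IsToricHermitianInstanton M J Ω) (R : RodStructure M a b)
    (hV : IsTodPotential J Ω a b R.ζ c V) :
    ∃ f : ℝ → ℝ, Continuous f ∧ (∀ s, 0 < f s) ∧
      (∀ s, Tendsto (flux (pullSqrt V)) (axisNhds s) (𝓝 (f s))) ∧
      ∀ i, ∃ m k : ℝ, ∀ s ∈ rod R.z i, f s = m * s + k := by
  have hT := hM.toric
  obtain ⟨H, hH, hform⟩ := hV.todForm
  obtain ⟨Φ, hΦc, hΦ⟩ := R.exists_descend (φ := fun p => (Ω p)⁻¹)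
    (hM.conformallyKahler.smooth.continuous.inv₀ fun p => (hM.conformallyKahler.pos p).ne')
    fun t p => by rw [conformalFactor_smul hM]
  obtain ⟨A, hAc, hA⟩ := R.exists_descend (continuous_gram hT a a) (gram_smul hT a a)
  obtain ⟨B, hBc, hB⟩ := R.exists_descend (continuous_gram hT a b) (gram_smul hT a b)
  obtain ⟨C, hCc, hC⟩ := R.exists_descend (continuous_gram hT b b) (gram_smul hT b b)
  have hWpos : ∀ r s, 0 < r → 0 < todW c V r s := fun r s hr => by
    obtain ⟨p, rfl, rfl⟩ := R.exists_point hr.le s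
    obtain ⟨U, τ, y, -, hp, -, h⟩ := hform p hr
    exact todW_pos hT R h hp hr
  have hTod := hV.harmonic.isTodOn hH hV.c_ne_zero hWpos
  -- the functions of the Tod form in terms of the invariant functions, away from the axis
  have hflux : ∀ q ∈ strip univ, flux (pullSqrt V) q = Φ (√q.1, q.2) := by
    rintro ⟨t, s⟩ ⟨ht, -⟩
    have hr := Real.sqrt_pos.2 (show 0 < t from ht)
    obtain ⟨p, hp1, hp2⟩ := R.exists_point hr.le s
    have h := flux_pullSqrt (s := s) hV.harmonic hr
    rw [Real.sq_sqrt (le_of_lt ht)] at h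
    rw [h, ← hp1, ← hp2, hΦ]
    exact (hV.conformalFactor p (hp1 ▸ hr)).symm
  have hgram : ∀ q ∈ strip univ, (pullSqrt (todW c V) q)⁻¹ = A (√q.1, q.2) ∧
      pullSqrt (todF c V H) q * (pullSqrt (todW c V) q)⁻¹ = B (√q.1, q.2) ∧
      pullSqrt (todF c V H) q ^ 2 * (pullSqrt (todW c V) q)⁻¹ + pullSqrt (todW c V) q * q.1
        = C (√q.1, q.2) := by
    rintro ⟨t, s⟩ ⟨ht, -⟩
    have hr := Real.sqrt_pos.2 (show 0 < t from ht)
    obtain ⟨p, hp1, hp2⟩ := R.exists_point hr.le s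
    obtain ⟨U, τ, y, -, hp, -, h⟩ := hform p (hp1 ▸ hr)
    obtain ⟨h1, h2, h3⟩ := gram_of_isTodFormOn hT R h hp
    rw [← hA, hp1, hp2] at h1
    rw [← hB, hp1, hp2] at h2
    rw [← hC, hp1, hp2, Real.sq_sqrt (le_of_lt ht)] at h3
    exact ⟨h1.symm, h2.symm, h3.symm⟩
  have hlim {G : ℝ × ℝ → ℝ} {K : ℝ × ℝ → ℝ} (hK : ContinuousOn K {q | 0 ≤ q.1})
      (h : ∀ q ∈ strip univ, G q = K (√q.1, q.2)) (s : ℝ) :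
      Tendsto G (axisNhds s) (𝓝 (K (0, s))) := by
    refine (tendsto_sqrt_axis hK s).congr' ?_
    filter_upwards [axisNhds_mem_strip isOpen_univ (mem_univ s)] with q hq using (h q hq).symm
  have hpos : ∀ s, 0 < Φ (0, s) := fun s => by
    obtain ⟨p, hp1, hp2⟩ := R.exists_point le_rfl s
    have e := hΦ p
    rw [hp1, hp2] at e
    rw [e]
    exact inv_pos.2 (hM.conformallyKahler.pos p)
  refine ⟨fun s => Φ (0, s), ?_, hpos, hlim hΦc hflux, fun i => ?_⟩
  · exact hΦc.comp_continuous (by fun_prop) fun s => le_refl (0 : ℝ)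
  have hI := isOpen_rod R.z i
  have hIc := ordConnected_rod R.z i
  have hTi := hTod.mono (subset_univ (rod R.z i))
  have hu : ∀ s ∈ rod R.z i, Tendsto (flux (pullSqrt V)) (axisNhds s) (𝓝 (Φ (0, s))) :=
    fun s _ => hlim hΦc hflux s
  have hWA := hlim hAc fun q hq => (hgram q hq).1
  have hFB := hlim hBc fun q hq => (hgram q hq).2.1
  have hWC := hlim hCc fun q hq => (hgram q hq).2.2
  rcases R.gram_on_rod hT i with h | ⟨F₀, h⟩
  · have h' : ∀ s ∈ rod R.z i, A (0, s) = 0 ∧ B (0, s) = 0 ∧ 0 < C (0, s) := fun s hs => by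
      obtain ⟨p, hp1, rfl⟩ := R.exists_point le_rfl s
      have e := And.intro (hA p) (And.intro (hB p) (hC p))
      rw [hp1] at e
      rw [e.1, e.2.1, e.2.2]
      exact h p hp1 hs
    obtain ⟨k, hk⟩ := hTi.const_of_eq_zero hI hIc (fun s _ => hpos s) (fun s hs => (h' s hs).2.2) hu
      (fun s hs => (h' s hs).1 ▸ hWA s) (fun s hs => (h' s hs).2.1 ▸ hFB s) fun s _ => hWC s
    exact ⟨0, k, fun s hs => (hk s hs).trans (by rw [zero_mul, zero_add])⟩
  · have h' : ∀ s ∈ rod R.z i, 0 < A (0, s) ∧ B (0, s) = F₀ * A (0, s) := fun s hs => by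
      obtain ⟨p, hp1, rfl⟩ := R.exists_point le_rfl s
      have e := And.intro (hA p) (hB p)
      rw [hp1] at e
      rw [e.1, e.2]
      exact h p hp1 hs
    exact hTi.affine_of_ne_zero hI hIc (fun s _ => hpos s) (fun s hs => (h' s hs).1) hu
      (fun s _ => hWA s) fun s hs => (h' s hs).2 ▸ hFB s

end Flux

end ToricInstanton

/-! ### The expansion of the potential -/

theorem mainTheorem8 {M : Type*} [MetricSpace M] [ChartedSpace ToricInstanton.E4 M]
    [IsManifold (𝓡 4) ∞ M]
    [RiemannianBundle (fun x : M => TangentSpace (𝓡 4) x)]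
    [IsContMDiffRiemannianBundle (𝓡 4) ∞ ToricInstanton.E4
      (fun x : M => TangentSpace (𝓡 4) x)]
    [IsRiemannianManifold (𝓡 4) M]
    [MulAction ToricInstanton.Torus M]
    (J : ToricInstanton.EndField M) (Ω : M → ℝ)
    (hM : ToricInstanton.IsToricHermitianInstanton M J Ω)
    (a b : ℝ × ℝ) (R : ToricInstanton.RodStructure M a b)
    (c : ℝ) (V : ℝ → ℝ → ℝ)
    (hV : ToricInstanton.IsTodPotential J Ω a b R.ζ c V) :
    ∃ f g : ℝ → ℝ,
      -- `f` is a positive piecewise linear function with breaks at the `z_i`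
      Continuous f ∧ (∀ s, 0 < f s) ∧
      (∀ i, ∃ m k : ℝ, ∀ s ∈ ToricInstanton.rod R.z i, f s = m * s + k) ∧
      -- `g` is piecewise smooth with breaks at the `z_i`
      (∀ i, ContDiffOn ℝ ∞ g (ToricInstanton.rod R.z i)) ∧
      -- on every rod the correction is a smooth function of `(ρ², ζ)` and is `O(ρ²)`
      ∀ i, ∃ E : ℝ × ℝ → ℝ,
        ContDiffOn ℝ ∞ E (Set.Ici 0 ×ˢ ToricInstanton.rod R.z i) ∧
        (∀ r s, 0 < r → s ∈ ToricInstanton.rod R.z i →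
          V r s = f s * Real.log (r ^ 2) + g s + E (r ^ 2, s)) ∧
        ∀ s₀ ∈ ToricInstanton.rod R.z i,
          (fun q : ℝ × ℝ => E (q.1 ^ 2, q.2)) =O[𝓝[>] 0 ×ˢ 𝓝 s₀] (fun q => q.1 ^ 2) := by
  obtain ⟨f, hf, hpos, hflux, haff⟩ := ToricInstanton.exists_flux hM R hV
  set v := ToricInstanton.pullSqrt V with hv
  have hharm := hV.harmonic.isHarmOn
  -- the expansion on a rod; by continuity its regular part determines `g` there
  have hexp : ∀ i, ∃ G : ℝ × ℝ → ℝ, ContDiffOn ℝ ∞ G (Set.Ici 0 ×ˢ ToricInstanton.rod R.z i) ∧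
      ∀ q ∈ ToricInstanton.strip (ToricInstanton.rod R.z i),
        v q = f q.2 * Real.log q.1 + G q := fun i => by
    obtain ⟨m, k, hmk⟩ := haff i
    obtain ⟨G, hG, h⟩ := (hharm.mono (Set.subset_univ _)).exists_expansion
      (ToricInstanton.isOpen_rod R.z i) (m := m) (k := k) fun s hs => hmk s hs ▸ hflux s
    exact ⟨G, hG, fun q hq => (h q hq).trans (by rw [hmk q.2 hq.2])⟩
  choose G hG hvG using hexp
  have hg : ∀ i, ∀ s ∈ ToricInstanton.rod R.z i,
      Filter.limUnder (𝓝[>] 0) (fun t => v (t, s) - f s * Real.log t) =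
        G i (0, s) := fun i s hs => by
    refine Filter.Tendsto.limUnder_eq ?_
    have hc : Filter.Tendsto (fun t => (t, s)) (𝓝[>] (0 : ℝ))
        (𝓝[Set.Ici 0 ×ˢ ToricInstanton.rod R.z i] (0, s)) := by
      refine tendsto_nhdsWithin_iff.2 ⟨?_, ?_⟩
      · exact (Filter.Tendsto.prodMk_nhds Filter.tendsto_id tendsto_const_nhds).mono_left
          nhdsWithin_le_nhds
      · filter_upwards [self_mem_nhdsWithin] with t ht using ⟨le_of_lt (Set.mem_Ioi.1 ht), hs⟩
    refine (((hG i).continuousOn (0, s) ⟨le_refl (0 : ℝ), hs⟩).tendsto.comp hc).congr' ?_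
    filter_upwards [self_mem_nhdsWithin] with t ht
    rw [hvG i (t, s) ⟨ht, hs⟩]
    simp
  have hax (i) : ContDiffOn ℝ ∞ (fun s => G i (0, s)) (ToricInstanton.rod R.z i) :=
    (hG i).comp (contDiff_const.prodMk contDiff_id).contDiffOn fun s hs => ⟨le_refl (0 : ℝ), hs⟩
  refine ⟨f, fun s => Filter.limUnder (𝓝[>] 0) (fun t => v (t, s) - f s * Real.log t), hf, hpos,
    haff, fun i => (hax i).congr (hg i), fun i => ⟨fun q => G i q - G i (0, q.2), ?_, ?_, ?_⟩⟩
  · exact (hG i).sub ((hax i).comp contDiffOn_snd fun q hq => hq.2)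
  · intro r s hr hs
    have h := hvG i (r ^ 2, s) ⟨pow_pos hr 2, hs⟩
    rw [hv, ToricInstanton.pullSqrt_sq V hr.le] at h
    refine h.trans ?_
    dsimp only
    rw [hg i s hs]
    ring
  · exact fun s₀ hs => ToricInstanton.isBigO_sub_axis (ToricInstanton.isOpen_rod R.z i)
      (ToricInstanton.ordConnected_rod R.z i) (hG i) hs
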